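/- Let $X=(V,E,T)$ be a finite $2$-dimensional simplicial complex (with vertex set $V$, edge set $E$ and a non-empty set $T$ of triangles) that is $(k_0,k_1)$-regular: every vertex lies in exactly $k_0$ edges and every edge lies in exactly $k_1$ triangles. For $S\subseteq V$ let $\delta(S)$ be the set of edges with exactly one endpoint in $S$; for $F\subseteq E$ let $\delta(F)$ be the set of triangles with an odd number of edges in $F$. Write $X(0)=V$, $X(1)=E$, $B^0(X)=\{\emptyset,V\}$, $B^1(X)=\{\delta(S): S\subseteq V\}$, $Z^i(X)=\{S\subseteq X(i): \delta(S)=\emptyset\}$, and $\operatorname{dist}(S,\mathcal T)=\min_{S'\in\mathcal T}(|S\setminus S'|+|S'\setminus S|)$. Suppose that $X$ is an $(\varepsilon,\mu)$-cosystolic expander with $\varepsilon,\mu>0$: for each $i\in\{0,1\}$ and each $S\subseteq X(i)$, * if $\delta(S)=\emptyset$, then $S\in B^i(X)$ or $|S|\ge \mu|X(i)|$; * otherwise $|\delta(S)|/\operatorname{dist}(S,Z^i(X))\ge \varepsilon k_i$. Let $\widetilde\lambda_2$ be the second largest eigenvalue (with multiplicity) of the adjacency matrix of the underlying graph $G_0(X)=(V,E)$,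 divided by $k_0$. Assume that $\widetilde\lambda_2<\tfrac12$ and that $|V|\ge 3/\mu$. Put $$\alpha = 1-\frac{\varepsilon^2}{128}\Bigl(3\sqrt{(1+2\widetilde\lambda_2)^2+32}-2\widetilde\lambda_2-17\Bigr)^2 .$$ Then the high order random walk on the edges of $X$, which moves from an edge $e$ to a uniformly random element of $N(e)=\{f\in E: e\cup f\in T\}$, is $\alpha$-rapidly mixing: $\alpha>0$, and for every initial probability distribution $\mathbf p_0$ on $E$ and every integer $i\ge 0$, the distribution $\mathbf p_i$ after $i$ steps satisfies $\|\mathbf p_i-\mathbf u\|_2\le\alpha^i$, where $\mathbf u$ is the uniform distribution on $E$. Moreover, the edge-graph $G_1(X)$, whose vertices are the edges of $X$ and in which $e,f$ are adjacent when $e\cup f\in T$, is an $\alpha$-spectral expander: it is $2k_1$-regular, $0<\alpha<1$, and its second largest and its least adjacency eigenvalues, divided by $2k_1$, have absolute value at most $\alpha$. -/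

import Mathlib

noncomputable section

/-- The `(i+1)`-st largest eigenvalue (with multiplicity) of the adjacency matrix of a finite
graph: `adjEigenvalue G 0 ≥ adjEigenvalue G 1 ≥ …` are `λ₁ ≥ λ₂ ≥ …` (and `0` when `i` is out
of range). -/
def adjEigenvalue {W : Type*} [Fintype W] (G : SimpleGraph W) (i : ℕ) : ℝ := by
  classical
  exact if h : i < Fintype.card W then
      (G.isHermitian_adjMatrix ℝ).eigenvalues₀ ⟨i, h⟩
    else 0

/-- The normalized second largest eigenvalue `λ₂ / k` of a `k`-regular graph. -/
def normalizedSecondEigenvalue {W : Type*} [Fintype W] (G : SimpleGraph W) (k : ℕ) : ℝ :=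
  adjEigenvalue G 1 / k

/-- The normalized least eigenvalue `λₙ / k` of a `k`-regular graph on `n` vertices. -/
def normalizedLeastEigenvalue {W : Type*} [Fintype W] (G : SimpleGraph W) (k : ℕ) : ℝ :=
  adjEigenvalue G (Fintype.card W - 1) / k

/-- `G` is a `k`-regular graph, all of whose non-trivial normalized eigenvalues have absolute
value at most `a`, where `0 < a < 1`. -/
def IsSpectralExpander {W : Type*} [Fintype W] (G : SimpleGraph W) (k : ℕ) (a : ℝ) : Prop :=
  (∀ w, (G.neighborSet w).ncard = k) ∧ 0 < a ∧ a < 1 ∧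
    max |normalizedSecondEigenvalue G k| |normalizedLeastEigenvalue G k| ≤ a

/-- `dist(S, 𝒯)`: the least value of `|S \ T| + |T \ S|` over `T ∈ 𝒯` (used for nonempty `𝒯`). -/
def setDist {α : Type*} [DecidableEq α] (S : Finset α) (𝒯 : Set (Finset α)) : ℕ :=
  sInf ((fun T => (S \ T).card + (T \ S).card) '' 𝒯)

namespace AbstractSimplicialComplex

variable {V : Type*}

/-- `X` has dimension two: its faces have at most three vertices and it has a triangle. -/
def IsTwoDimensional (X : AbstractSimplicialComplex V) : Prop :=
  (∀ s ∈ X.faces, s.card ≤ 3) ∧ ∃ s ∈ X.faces, s.card = 3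

variable [Fintype V]

open Classical in
/-- The set `E` of edges of `X`. -/
def edges (X : AbstractSimplicialComplex V) : Finset (Finset V) :=
  Finset.univ.filter (fun s => s ∈ X.faces ∧ s.card = 2)

open Classical in
/-- The set `T` of triangles of `X`. -/
def triangles (X : AbstractSimplicialComplex V) : Finset (Finset V) :=
  Finset.univ.filter (fun s => s ∈ X.faces ∧ s.card = 3)

theorem card_edge (X : AbstractSimplicialComplex V) : ∀ e ∈ X.edges, e.card = 2 := by
  intro e he
  simp only [edges, Finset.mem_filter] at he
  exact he.2.2

theorem card_triangle (X : AbstractSimplicialComplex V) : ∀ t ∈ X.triangles, t.card = 3 := by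
  intro t ht
  simp only [triangles, Finset.mem_filter] at ht
  exact ht.2.2

variable [DecidableEq V]

/-- Every vertex lies in exactly `k₀` edges and every edge lies in exactly `k₁` triangles. -/
def IsRegular (X : AbstractSimplicialComplex V) (k₀ k₁ : ℕ) : Prop :=
  (∀ v : V, (X.edges.filter (fun e => v ∈ e)).card = k₀) ∧
    ∀ e ∈ X.edges, (X.triangles.filter (fun t => e ⊆ t)).card = k₁

/-- The coboundary of a set of vertices: the edges with exactly one endpoint in `S`. -/
def coboundary₀ (X : AbstractSimplicialComplex V) (S : Finset V) : Finset (Finset V) :=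
  X.edges.filter (fun e => (e ∩ S).card = 1)

/-- The coboundary of a set of edges: the triangles with an odd number of edges in `F`. -/
def coboundary₁ (X : AbstractSimplicialComplex V) (F : Finset (Finset V)) : Finset (Finset V) :=
  X.triangles.filter (fun t => Odd (F.filter (fun e => e ⊆ t)).card)

/-- `B⁰(X)`. -/
def trivialZeros₀ (_X : AbstractSimplicialComplex V) : Set (Finset V) := {∅, Finset.univ}

/-- `Z⁰(X)`. -/
def cocycles₀ (X : AbstractSimplicialComplex V) : Set (Finset V) :=
  {S | (X.coboundary₀ S).card = 0}

/-- `B¹(X)`: the cuts of the complex. -/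
def trivialZeros₁ (X : AbstractSimplicialComplex V) : Set (Finset (Finset V)) :=
  Set.range X.coboundary₀

/-- `Z¹(X)`. -/
def cocycles₁ (X : AbstractSimplicialComplex V) : Set (Finset (Finset V)) :=
  {F | F ⊆ X.edges ∧ (X.coboundary₁ F).card = 0}

/-- `(ε, μ)`-cosystolic expansion of a `(k₀, k₁)`-regular complex. If the coboundary of a set is
nonempty then its distance from the cocycles is positive, so that the quotient of the two
cardinalities is at least `ε kᵢ` exactly when the product form below holds. -/
def IsCosystolicExpander (X : AbstractSimplicialComplex V) (k₀ k₁ : ℕ) (ε μ : ℝ) : Prop :=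
  0 < ε ∧ 0 < μ ∧
  (∀ S : Finset V,
    ((X.coboundary₀ S).card = 0 →
      S ∈ X.trivialZeros₀ ∨ μ * (Fintype.card V : ℝ) ≤ (S.card : ℝ)) ∧
    ((X.coboundary₀ S).card ≠ 0 →
      ε * k₀ * (setDist S X.cocycles₀ : ℝ) ≤ ((X.coboundary₀ S).card : ℝ))) ∧
  (∀ F : Finset (Finset V), F ⊆ X.edges →
    ((X.coboundary₁ F).card = 0 →
      F ∈ X.trivialZeros₁ ∨ μ * (X.edges.card : ℝ) ≤ (F.card : ℝ)) ∧
    ((X.coboundary₁ F).card ≠ 0 →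
      ε * k₁ * (setDist F X.cocycles₁ : ℝ) ≤ ((X.coboundary₁ F).card : ℝ)))

/-- The underlying graph `G₀(X) = (V, E)`. -/
def underlyingGraph (X : AbstractSimplicialComplex V) : SimpleGraph V where
  Adj u v := ({u, v} : Finset V) ∈ X.edges
  symm := ⟨fun u v h => by rwa [Finset.pair_comm]⟩
  loopless := ⟨fun u h => by simpa using X.card_edge _ h⟩

/-- The edges of `X`, as a type. -/
abbrev Edge (X : AbstractSimplicialComplex V) : Type _ := {e : Finset V // e ∈ X.edges}

/-- The edge-graph `G₁(X)`: its vertices are the edges of `X`, two of them being adjacent when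
their union is a triangle of `X`. -/
def edgeGraph (X : AbstractSimplicialComplex V) : SimpleGraph X.Edge where
  Adj e f := e.1 ∪ f.1 ∈ X.triangles
  symm := ⟨fun e f h => by rwa [Finset.union_comm]⟩
  loopless := ⟨fun e h => by
    have h2 := X.card_edge _ e.2
    have h3 := X.card_triangle _ h
    rw [Finset.union_self] at h3
    omega⟩

/-- The neighbours `N(e)` of an edge in the high order random walk. -/
def edgeNeighbors (X : AbstractSimplicialComplex V) (e : X.Edge) : Finset X.Edge :=
  Finset.univ.filter (fun f => e.1 ∪ f.1 ∈ X.triangles)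

/-- One step of the high order random walk: from `e` it moves to a uniformly random element of
`N(e)`, so the new probability of `f` is the sum of `p e / |N(e)|` over all `e` with
`f ∈ N(e)`. -/
def walkStep (X : AbstractSimplicialComplex V) (p : X.Edge → ℝ) : X.Edge → ℝ := fun f =>
  ∑ e : X.Edge, if f ∈ X.edgeNeighbors e then p e * (1 / ((X.edgeNeighbors e).card : ℝ)) else 0

/-- The distribution after `i` steps of the high order random walk started from `p₀`. -/
def walkDistribution (X : AbstractSimplicialComplex V) (p₀ : X.Edge → ℝ) (i : ℕ) : X.Edge → ℝ :=
  X.walkStep^[i] p₀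

/-- The high order random walk is `a`-rapidly mixing: whatever the initial probability
distribution, after `i` steps its Euclidean distance from the uniform one is at most `a ^ i`. -/
def IsRapidlyMixing (X : AbstractSimplicialComplex V) (a : ℝ) : Prop :=
  0 < a ∧ ∀ p₀ ∈ stdSimplex ℝ X.Edge, ∀ i : ℕ,
    ‖WithLp.toLp 2 (fun e : X.Edge =>
      X.walkDistribution p₀ i e - 1 / (X.edges.card : ℝ))‖ ≤ a ^ i

end AbstractSimplicialComplex

end

/-! Both claims follow from one estimate: on functions of mean zero, the quadratic form of the
edge-graph lies between `-k₁` and `α · 2k₁` times the squared norm. With `B` the triangle–edge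
incidence matrix, the adjacency matrix is `BᵀB - k₁ I`, which gives the lower end. As `α ≥ 1/2`, the
form is then at most `α · 2k₁` in absolute value, so the walk contracts mean-zero functions by `α`.

The upper end is Cheeger's inequality (`cheeger`), which needs the edge expansion of `F ⊆ E` with
`2|F| ≤ |E|` (`expansion_edgeGraph`). Let `F_v` be the set of edges of `F` at `v`. A triangle with
`j` edges in `F` contributes `j(3 - j)` to the boundary of `F`, and this dominates the number of `v`
for which the triangle lies in `δ(F_v)`. So the boundary is at least `∑ |δ(F_v)|`. Every nonempty
1-cocycle has at least `k₀` edges: either it is a cut, bounded below through `λ₂`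
(`degree_le_card_coboundary₀`), or it is large by cosystolic expansion. Hence `|δ(F_v)| ≥ ε k₁
min(|F_v|, k₀ - |F_v|)`.

It remains to bound `M = ∑ min(|F_v|, k₀ - |F_v|)` below by a multiple of `|F|` (`card_le_sum_min`).
Let `A` be the set of vertices at which more than half of the edges are in `F`. If `M` were small,
`F` would nearly be the set of edges at `A`, and the cut of `A` would be small because it has at
most `M` edges. The spectral gap of the underlying graph excludes this, since `F` has at most half
of the edges. -/

/-- The adjacency kernel of a graph. -/
noncomputable def SimpleGraph.kernel {W : Type*} (G : SimpleGraph W) : W → W → ℝ := by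
  classical
  exact fun u v => if G.Adj u v then 1 else 0

theorem SimpleGraph.kernel_symm {W : Type*} (G : SimpleGraph W) (u v : W) :
    G.kernel u v = G.kernel v u := by
  classical
  exact if_congr (G.adj_comm u v) rfl rfl

theorem SimpleGraph.kernel_nonneg {W : Type*} (G : SimpleGraph W) (u v : W) :
    0 ≤ G.kernel u v := by
  unfold SimpleGraph.kernel
  split_ifs <;> simp

theorem SimpleGraph.kernel_eq_ite {W : Type*} (G : SimpleGraph W) (u v : W)
    [Decidable (G.Adj u v)] : G.kernel u v = if G.Adj u v then 1 else 0 := by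
  unfold SimpleGraph.kernel
  congr

/-! ### Eigenvalues and quadratic forms of symmetric kernels -/

section Spectral

variable {W : Type*} [Fintype W]

/-- The quadratic form of a kernel. -/
def quadForm (w : W → W → ℝ) (x : W → ℝ) : ℝ := ∑ u, ∑ v, w u v * (x u * x v)

/-- The spectral theorem with the basis indexed by rank rather than by vertices, so that positions 0
and 1 carry the first and second eigenvalues. -/
theorem exists_adj_eigenbasis (G : SimpleGraph W) :
    ∃ b : OrthonormalBasis (Fin (Fintype.card W)) ℝ (EuclideanSpace ℝ W),
      (∀ i u, ∑ v, G.kernel u v * b i v = adjEigenvalue G i * b i u) ∧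
      ∀ i j : Fin (Fintype.card W), i ≤ j → adjEigenvalue G j ≤ adjEigenvalue G i := by
  classical
  have hA := G.isHermitian_adjMatrix ℝ
  set σ := Fintype.equivOfCardEq (α := Fin (Fintype.card W)) (β := W) (Fintype.card_fin _) with hσ
  have hev : ∀ i : Fin (Fintype.card W), adjEigenvalue G i = hA.eigenvalues₀ i := by
    intro i
    unfold adjEigenvalue
    rw [dif_pos i.2]
  refine ⟨hA.eigenvectorBasis.reindex σ.symm, fun i u => ?_, fun i j hij => ?_⟩
  · have h := congrFun (hA.mulVec_eigenvectorBasis (σ i)) u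
    rw [hev]
    simp only [Matrix.mulVec, dotProduct, SimpleGraph.adjMatrix_apply, Pi.smul_apply,
      smul_eq_mul, Matrix.IsHermitian.eigenvalues, ← hσ, Equiv.symm_apply_apply] at h
    simp only [OrthonormalBasis.reindex_apply, Equiv.symm_symm, SimpleGraph.kernel]
    convert h
  · rw [hev, hev]
    exact hA.eigenvalues₀_antitone hij

theorem EuclideanSpace.inner_eq_sum_mul (x y : EuclideanSpace ℝ W) :
    inner ℝ x y = ∑ u, x u * y u := by
  simp [PiLp.inner_apply, mul_comm]

theorem sum_kernel_mul_comm {w : W → W → ℝ} (hw : ∀ u v, w u v = w v u) (x y : W → ℝ) :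
    ∑ u, x u * ∑ v, w u v * y v = ∑ u, (∑ v, w u v * x v) * y u := by
  simp only [Finset.mul_sum, Finset.sum_mul]
  rw [Finset.sum_comm]
  refine Finset.sum_congr rfl fun u _ => Finset.sum_congr rfl fun v _ => ?_
  rw [hw u v]; ring

theorem quadForm_eq (w : W → W → ℝ) (x : W → ℝ) :
    quadForm w x = ∑ u, x u * ∑ v, w u v * x v := by
  simp only [quadForm, Finset.mul_sum]
  refine Finset.sum_congr rfl fun u _ => Finset.sum_congr rfl fun v _ => ?_
  ring

/-- Expansion of the quadratic form in an orthonormal basis of eigenvectors. -/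
theorem quadForm_eq_sum_eigenbasis {n : ℕ} {w : W → W → ℝ} (hw : ∀ u v, w u v = w v u)
    (b : OrthonormalBasis (Fin n) ℝ (EuclideanSpace ℝ W)) (μ : Fin n → ℝ)
    (hb : ∀ i u, ∑ v, w u v * b i v = μ i * b i u) (x : EuclideanSpace ℝ W) :
    quadForm w x = ∑ i, μ i * inner ℝ (b i) x ^ 2 := by
  set y : EuclideanSpace ℝ W := WithLp.toLp 2 fun u => ∑ v, w u v * x v with hy
  have h1 : quadForm w x = inner ℝ x y := by
    rw [quadForm_eq, EuclideanSpace.inner_eq_sum_mul]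
  have h2 : ∀ i, inner ℝ (b i) y = μ i * inner ℝ (b i) x := by
    intro i
    rw [EuclideanSpace.inner_eq_sum_mul, EuclideanSpace.inner_eq_sum_mul]
    simp only [hy]
    rw [sum_kernel_mul_comm hw, Finset.mul_sum]
    simp only [hb, mul_assoc]
  rw [h1, ← b.sum_inner_mul_inner x y]
  refine Finset.sum_congr rfl fun i _ => ?_
  rw [h2, real_inner_comm]; ring

theorem sum_sq_eq_sum_inner_sq {n : ℕ} (b : OrthonormalBasis (Fin n) ℝ (EuclideanSpace ℝ W))
    (x : EuclideanSpace ℝ W) : ∑ u, x u ^ 2 = ∑ i, inner ℝ (b i) x ^ 2 := by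
  have h : inner ℝ x x = ∑ u, x u ^ 2 := by
    rw [EuclideanSpace.inner_eq_sum_mul]; simp only [sq]
  rw [← h, ← b.sum_inner_mul_inner x x]
  refine Finset.sum_congr rfl fun i _ => ?_
  rw [real_inner_comm]; ring

/-- For a regular graph whose second eigenvalue is less than its degree, the second eigenvalue
bounds the quadratic form on functions of mean zero. -/
theorem quadForm_le_secondEigenvalue (G : SimpleGraph W) {k : ℝ}
    (hreg : ∀ u, ∑ v, G.kernel u v = k) (hlt : adjEigenvalue G 1 < k)
    (x : W → ℝ) (hx : ∑ u, x u = 0) :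
    quadForm G.kernel x ≤ adjEigenvalue G 1 * ∑ u, x u ^ 2 := by
  obtain ⟨b, hb, hanti⟩ := exists_adj_eigenbasis G
  set X : EuclideanSpace ℝ W := WithLp.toLp 2 x
  set o : EuclideanSpace ℝ W := WithLp.toLp 2 fun _ => (1 : ℝ) with ho
  have hle : ∀ i : Fin (Fintype.card W), (i : ℕ) ≠ 0 → adjEigenvalue G i ≤ adjEigenvalue G 1 := by
    intro i hi
    -- A nonzero index `i` forces at least two vertices, so index 1 is in range and its eigenvalue
    -- is not the default 0.
    have := hanti ⟨1, by have := i.2; omega⟩ i (by rw [Fin.le_def]; simp; omega)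
    simpa using this
  -- The constants have eigenvalue `k`, which differs from every later eigenvalue; so they span the
  -- line of `b 0`, and mean zero means orthogonal to `b 0`.
  have horth : ∀ i : Fin (Fintype.card W), (i : ℕ) ≠ 0 → inner ℝ (b i) o = 0 := by
    intro i hi
    have h1 : ∑ u, (b i u) * ∑ v, G.kernel u v * o v = k * inner ℝ (b i) o := by
      simp [ho, hreg, EuclideanSpace.inner_eq_sum_mul, Finset.mul_sum, mul_comm]
    rw [sum_kernel_mul_comm G.kernel_symm] at h1
    simp only [hb, mul_assoc] at h1
    rw [← Finset.mul_sum, ← EuclideanSpace.inner_eq_sum_mul] at h1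
    have h2 : (k - adjEigenvalue G i) * inner ℝ (b i) o = 0 := by linarith
    rcases mul_eq_zero.1 h2 with h | h
    · linarith [hle i hi]
    · exact h
  have hxo : inner ℝ X o = 0 := by
    simp [ho, EuclideanSpace.inner_eq_sum_mul, X, hx]
  have hx0 : ∀ i : Fin (Fintype.card W), (i : ℕ) = 0 → inner ℝ (b i) X = 0 := by
    intro i hi
    have h1 := b.sum_inner_mul_inner X o
    rw [hxo, Finset.sum_eq_single i] at h1
    · rcases mul_eq_zero.1 h1 with h | h
      · rwa [real_inner_comm]
      · exfalso
        have h2 := b.sum_inner_mul_inner o o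
        rw [Finset.sum_eq_single i] at h2
        · rw [h, mul_zero] at h2
          have hpos : (0 : ℝ) < Fintype.card W := by exact_mod_cast i.pos
          rw [EuclideanSpace.inner_eq_sum_mul] at h2
          simp only [ho, mul_one, Finset.sum_const, Finset.card_univ, nsmul_eq_mul] at h2
          linarith
        · intro j _ hj
          rw [horth j (fun h => hj (Fin.ext (h.trans hi.symm))), mul_zero]
        · simp
    · intro j _ hj
      rw [horth j (fun h => hj (Fin.ext (h.trans hi.symm))), mul_zero]
    · simp
  have e1 := quadForm_eq_sum_eigenbasis G.kernel_symm b _ hb X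
  have e2 := sum_sq_eq_sum_inner_sq b X
  change quadForm G.kernel x = _ at e1
  change ∑ u, x u ^ 2 = _ at e2
  rw [e1, e2, Finset.mul_sum]
  refine Finset.sum_le_sum fun i _ => ?_
  by_cases hi : (i : ℕ) = 0
  · simp [hx0 i hi]
  · exact mul_le_mul_of_nonneg_right (hle i hi) (sq_nonneg _)

/-- A bound for the quadratic form on functions of mean zero bounds the second eigenvalue. -/
theorem secondEigenvalue_le (G : SimpleGraph W) (hcard : 2 ≤ Fintype.card W) {a : ℝ}
    (h : ∀ x : W → ℝ, ∑ u, x u = 0 → quadForm G.kernel x ≤ a * ∑ u, x u ^ 2) :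
    adjEigenvalue G 1 ≤ a := by
  obtain ⟨b, hb, hanti⟩ := exists_adj_eigenbasis G
  set i₀ : Fin (Fintype.card W) := ⟨0, by omega⟩ with hi₀
  set i₁ : Fin (Fintype.card W) := ⟨1, by omega⟩ with hi₁
  have hne : i₀ ≠ i₁ := by simp [hi₀, hi₁]
  set s₀ := ∑ u, b i₀ u
  set s₁ := ∑ u, b i₁ u
  -- As in Courant–Fischer: the plane of the top two eigenvectors meets the hyperplane of mean zero
  -- in a nonzero vector.
  obtain ⟨p, q, hpq, hsum⟩ : ∃ p q : ℝ, 0 < p ^ 2 + q ^ 2 ∧ p * s₀ + q * s₁ = 0 := by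
    by_cases hs : s₀ = 0
    · exact ⟨1, 0, by norm_num, by simp [hs]⟩
    · exact ⟨s₁, -s₀, by have := sq_pos_of_ne_zero hs; nlinarith [sq_nonneg s₁], by ring⟩
  set X : EuclideanSpace ℝ W := p • b i₀ + q • b i₁ with hX
  have hXs : ∑ u, X u = 0 := by
    simp only [hX, PiLp.add_apply, PiLp.smul_apply, smul_eq_mul, Finset.sum_add_distrib,
      ← Finset.mul_sum]
    exact hsum
  have hin : ∀ i, inner ℝ (b i) X = if i = i₀ then p else if i = i₁ then q else 0 := by
    intro i
    rw [hX, inner_add_right, inner_smul_right, inner_smul_right,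
      orthonormal_iff_ite.1 b.orthonormal, orthonormal_iff_ite.1 b.orthonormal]
    split_ifs with h1 h2 <;> simp_all
  have e : ∀ f : Fin (Fintype.card W) → ℝ,
      ∑ i, f i * inner ℝ (b i) X ^ 2 = f i₀ * p ^ 2 + f i₁ * q ^ 2 := by
    intro f
    have : ∀ i, f i * inner ℝ (b i) X ^ 2 =
        (if i = i₀ then f i₀ * p ^ 2 else 0) + (if i = i₁ then f i₁ * q ^ 2 else 0) := by
      intro i
      rw [hin]
      split_ifs with h1 h2 <;> simp_all
    simp [this, Finset.sum_add_distrib]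
  have e1 := quadForm_eq_sum_eigenbasis G.kernel_symm b _ hb X
  have e2 := sum_sq_eq_sum_inner_sq b X
  have e3 := e fun _ => 1
  simp only [one_mul] at e3
  have h' := h X hXs
  rw [e1, e2, e, e3] at h'
  have h01 : adjEigenvalue G i₁ ≤ adjEigenvalue G i₀ := hanti _ _ (by simp [hi₀, hi₁])
  have : adjEigenvalue G i₁ * (p ^ 2 + q ^ 2) ≤ a * (p ^ 2 + q ^ 2) := by
    nlinarith [sq_nonneg p]
  exact le_of_mul_le_mul_right this hpq

/-- A lower bound for the quadratic form is a lower bound for the eigenvalues. -/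
theorem le_adjEigenvalue (G : SimpleGraph W) {a : ℝ}
    (h : ∀ x : W → ℝ, a * ∑ u, x u ^ 2 ≤ quadForm G.kernel x) {i : ℕ}
    (hi : i < Fintype.card W) : a ≤ adjEigenvalue G i := by
  obtain ⟨b, hb, -⟩ := exists_adj_eigenbasis G
  have e1 := quadForm_eq_sum_eigenbasis G.kernel_symm b _ hb (b ⟨i, hi⟩)
  have e2 := sum_sq_eq_sum_inner_sq b (b ⟨i, hi⟩)
  have h' := h (b ⟨i, hi⟩)
  simp only [orthonormal_iff_ite.1 b.orthonormal, ite_pow, one_pow, ne_eq, OfNat.ofNat_ne_zero,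
    not_false_eq_true, zero_pow, mul_ite, mul_one, mul_zero, Finset.sum_ite_eq',
    Finset.mem_univ, if_true] at e1 e2
  rw [e1, e2] at h'
  simpa using h'

theorem adjEigenvalue_antitone (G : SimpleGraph W) {i j : ℕ} (hij : i ≤ j)
    (hj : j < Fintype.card W) : adjEigenvalue G j ≤ adjEigenvalue G i := by
  obtain ⟨b, -, hanti⟩ := exists_adj_eigenbasis G
  exact hanti ⟨i, by omega⟩ ⟨j, hj⟩ hij

/-- If the quadratic form of a symmetric kernel of constant row sums is bounded by `a` in absolute
value on functions of mean zero, then the operator is a contraction by `a` there. -/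
theorem sum_sq_kernel_le {w : W → W → ℝ} (hw : ∀ u v, w u v = w v u) {k a : ℝ}
    (hreg : ∀ u, ∑ v, w u v = k) (ha : 0 < a)
    (h : ∀ x : W → ℝ, ∑ u, x u = 0 → |quadForm w x| ≤ a * ∑ u, x u ^ 2)
    (x : W → ℝ) (hx : ∑ u, x u = 0) :
    ∑ u, (∑ v, w u v * x v) ^ 2 ≤ a ^ 2 * ∑ u, x u ^ 2 := by
  set y : W → ℝ := fun u => ∑ v, w u v * x v with hy
  have hys : ∑ u, y u = 0 := by
    have := sum_kernel_mul_comm hw (fun _ => 1) x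
    simp only [one_mul, mul_one, hreg, ← Finset.mul_sum, hx, mul_zero] at this
    exact this
  -- Polarization with `y = w x`: the forms at `a x + y` and `a x - y` differ by `4a‖y‖²`, while the
  -- hypothesis and the parallelogram law bound the difference by `a(2a²‖x‖² + 2‖y‖²)`.
  have key : ∀ s : ℝ, quadForm w (fun u => a * x u + s * y u) =
      a ^ 2 * quadForm w x + 2 * (a * s) * ∑ u, y u ^ 2 + s ^ 2 * quadForm w y := by
    intro s
    have h1 : ∑ u, y u ^ 2 = ∑ u, ∑ v, w u v * (y u * x v) := by
      refine Finset.sum_congr rfl fun u _ => ?_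
      rw [sq]; nth_rw 2 [hy]
      simp only [Finset.mul_sum]
      exact Finset.sum_congr rfl fun v _ => by ring
    have h2 : ∑ u, y u ^ 2 = ∑ u, ∑ v, w u v * (x u * y v) := by
      rw [h1, Finset.sum_comm]
      refine Finset.sum_congr rfl fun u _ => Finset.sum_congr rfl fun v _ => ?_
      rw [hw]; ring
    have h3 : 2 * (a * s) * ∑ u, y u ^ 2 = (a * s) * (∑ u, ∑ v, w u v * (y u * x v)) +
        (a * s) * ∑ u, ∑ v, w u v * (x u * y v) := by rw [← h1, ← h2]; ring
    rw [h3]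
    simp only [quadForm, Finset.mul_sum, ← Finset.sum_add_distrib]
    exact Finset.sum_congr rfl fun u _ => Finset.sum_congr rfl fun v _ => by ring
  have hsum : ∀ s : ℝ, ∑ u, (a * x u + s * y u) = 0 := by
    intro s
    rw [Finset.sum_add_distrib, ← Finset.mul_sum, ← Finset.mul_sum, hx, hys]; ring
  have hsq : ∑ u, (a * x u + 1 * y u) ^ 2 + ∑ u, (a * x u + (-1) * y u) ^ 2 =
      2 * a ^ 2 * ∑ u, x u ^ 2 + 2 * ∑ u, y u ^ 2 := by
    simp only [Finset.mul_sum, ← Finset.sum_add_distrib]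
    exact Finset.sum_congr rfl fun u _ => by ring
  have h1 := (abs_le.1 (h _ (hsum 1))).2
  have h2 := (abs_le.1 (h _ (hsum (-1)))).1
  rw [key] at h1 h2
  have h4 : 4 * a * ∑ u, y u ^ 2 ≤ a * (2 * a ^ 2 * ∑ u, x u ^ 2 + 2 * ∑ u, y u ^ 2) := by
    rw [← hsq]; linarith
  have h5 : a * ∑ u, y u ^ 2 ≤ a * (a ^ 2 * ∑ u, x u ^ 2) := by linarith
  exact le_of_mul_le_mul_left h5 ha

end Spectral

/-! ### Cheeger's inequality for weighted regular graphs -/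

section Cheeger

variable {W : Type*} [Fintype W]

/-- The total weight leaving a set. -/
def cutWeight [DecidableEq W] (w : W → W → ℝ) (F : Finset W) : ℝ := ∑ u ∈ F, ∑ v ∈ Fᶜ, w u v

theorem sum_abs_indicator_sub [DecidableEq W] {w : W → W → ℝ} (hw : ∀ u v, w u v = w v u) (F : Finset W) :
    ∑ u, ∑ v, w u v * |(if u ∈ F then (1 : ℝ) else 0) - (if v ∈ F then 1 else 0)| =
      2 * cutWeight w F := by
  have h : ∀ u v, w u v * |(if u ∈ F then (1 : ℝ) else 0) - (if v ∈ F then 1 else 0)| =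
      (if u ∈ F then (if v ∈ Fᶜ then w u v else 0) else 0) +
        (if v ∈ F then (if u ∈ Fᶜ then w v u else 0) else 0) := by
    intro u v
    rw [hw v u]
    by_cases hu : u ∈ F <;> by_cases hv : v ∈ F <;> simp [hu, hv]
  have h2 : ∑ u, ∑ v, (if u ∈ F then (if v ∈ Fᶜ then w u v else 0) else 0) = cutWeight w F := by
    unfold cutWeight
    rw [← Finset.sum_filter_add_sum_filter_not Finset.univ (fun u => u ∈ F)]
    simp [Finset.sum_ite, Finset.filter_not, Finset.compl_eq_univ_sdiff]
  simp only [h, Finset.sum_add_distrib]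
  rw [h2, Finset.sum_comm, h2]; ring

/-- The co-area inequality. -/
theorem coarea [DecidableEq W] {w : W → W → ℝ} (hw : ∀ u v, w u v = w v u) {c : ℝ}
    (hexp : ∀ F : Finset W, 2 * F.card ≤ Fintype.card W → c * F.card ≤ cutWeight w F) :
    ∀ (n : ℕ) (f : W → ℝ), (∀ u, 0 ≤ f u) →
      (Finset.univ.filter fun u => 0 < f u).card = n → 2 * n ≤ Fintype.card W →
      2 * c * ∑ u, f u ≤ ∑ u, ∑ v, w u v * |f u - f v| := by
  intro n
  induction n using Nat.strong_induction_on with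
  | _ n ih =>
    intro f hf hn hcard
    set S := Finset.univ.filter fun u => 0 < f u with hS
    have hout : ∀ u, u ∉ S → f u = 0 := fun u hu =>
      le_antisymm (not_lt.1 fun h => hu (by simp [hS, h])) (hf u)
    rcases S.eq_empty_or_nonempty with hempty | hne
    · have hzero : ∀ u, f u = 0 := fun u => hout u (by simp [hempty])
      simp [hzero]
    obtain ⟨m, hmS, hmin⟩ := S.exists_min_image f hne
    have hmpos : 0 < f m := by simpa [hS] using hmS
    -- Remove the lowest layer of `f`. The minimizer `m` leaves the support, and both sides of the
    -- inequality are additive over this layer and the rest.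
    set g : W → ℝ := fun u => f u - f m * (if u ∈ S then 1 else 0) with hg
    have hg0 : ∀ u, 0 ≤ g u := by
      intro u
      by_cases hu : u ∈ S
      · simpa [hg, hu] using hmin u hu
      · simpa [hg, hu] using hf u
    have hlt : (Finset.univ.filter fun u => 0 < g u).card < n := by
      rw [← hn]
      refine Finset.card_lt_card ⟨fun u hu => ?_, fun hsub => ?_⟩
      · by_contra hu'
        simp [hg, hu', hout u hu'] at hu
      · have := hsub hmS
        simp [hg, hmS] at this
    have h1 := ih _ hlt g hg0 rfl (by omega)
    have h2 := hexp S (by omega)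
    have hsum : ∑ u, f u = ∑ u, g u + f m * S.card := by
      simp [hg, Finset.sum_sub_distrib, mul_comm]
    have hsplit : ∀ u v, w u v * |f u - f v| = w u v * |g u - g v| +
        f m * (w u v * |(if u ∈ S then (1 : ℝ) else 0) - (if v ∈ S then 1 else 0)|) := by
      intro u v
      by_cases hu : u ∈ S <;> by_cases hv : v ∈ S
      · simp [hg, hu, hv]
      · have := hmin u hu
        have hv0 := hout v hv
        simp only [hg, hu, hv, hv0, if_true, if_false]
        rw [abs_of_nonneg (by linarith), abs_of_nonneg (by linarith)]
        simp; ring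
      · have := hmin v hv
        have hu0 := hout u hu
        simp only [hg, hu, hv, hu0, if_true, if_false]
        rw [abs_of_nonpos (by linarith), abs_of_nonpos (by linarith)]
        simp; ring
      · simp [hg, hu, hv]
    simp only [hsplit, Finset.sum_add_distrib, ← Finset.mul_sum, sum_abs_indicator_sub hw]
    rw [hsum]
    nlinarith [mul_le_mul_of_nonneg_left h2 hmpos.le]

/-- The Dirichlet energy of a function (each unordered pair is counted twice). -/
def dirichlet (w : W → W → ℝ) (f : W → ℝ) : ℝ := ∑ u, ∑ v, w u v * (f u - f v) ^ 2

theorem sum_row_sq {w : W → W → ℝ} {k : ℝ} (hreg : ∀ u, ∑ v, w u v = k) (f : W → ℝ) :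
    ∑ u, ∑ v, w u v * f u ^ 2 = k * ∑ u, f u ^ 2 := by
  simp only [← Finset.sum_mul, hreg, Finset.mul_sum]

theorem sum_col_sq {w : W → W → ℝ} (hw : ∀ u v, w u v = w v u) {k : ℝ}
    (hreg : ∀ u, ∑ v, w u v = k) (f : W → ℝ) :
    ∑ u, ∑ v, w u v * f v ^ 2 = k * ∑ u, f u ^ 2 := by
  rw [Finset.sum_comm, ← sum_row_sq hreg]
  exact Finset.sum_congr rfl fun u _ => Finset.sum_congr rfl fun v _ => by rw [hw]

theorem dirichlet_eq {w : W → W → ℝ} (hw : ∀ u v, w u v = w v u) {k : ℝ}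
    (hreg : ∀ u, ∑ v, w u v = k) (f : W → ℝ) :
    dirichlet w f = 2 * (k * ∑ u, f u ^ 2 - quadForm w f) := by
  have h : dirichlet w f = ∑ u, ∑ v, w u v * f u ^ 2 + ∑ u, ∑ v, w u v * f v ^ 2 -
      2 * quadForm w f := by
    simp only [dirichlet, quadForm, Finset.mul_sum, ← Finset.sum_add_distrib,
      ← Finset.sum_sub_distrib]
    exact Finset.sum_congr rfl fun u _ => Finset.sum_congr rfl fun v _ => by ring
  rw [h, sum_row_sq hreg, sum_col_sq hw hreg]; ring

/-- Cheeger's inequality for nonnegative functions of small support. -/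
theorem dirichlet_ge_of_small_support [DecidableEq W] {w : W → W → ℝ} (hw : ∀ u v, w u v = w v u)
    (hw0 : ∀ u v, 0 ≤ w u v) {k h : ℝ} (hh : 0 < h) (hreg : ∀ u, ∑ v, w u v = k)
    (hexp : ∀ F : Finset W, 2 * F.card ≤ Fintype.card W → h * k * F.card ≤ cutWeight w F)
    (f : W → ℝ) (hf : ∀ u, 0 ≤ f u)
    (hsupp : 2 * (Finset.univ.filter fun u => 0 < f u).card ≤ Fintype.card W) :
    h ^ 2 * k * ∑ u, f u ^ 2 ≤ dirichlet w f := by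
  have hfil : (Finset.univ.filter fun u => 0 < f u ^ 2) = Finset.univ.filter fun u => 0 < f u := by
    refine Finset.filter_congr fun u _ => ?_
    refine ⟨fun h' => (hf u).lt_of_ne ?_, fun h' => by positivity⟩
    intro h0
    rw [← h0] at h'
    norm_num at h'
  have h1 := coarea hw hexp _ (fun u => f u ^ 2) (fun u => sq_nonneg _) rfl (by rwa [hfil])
  have h2 : ∑ u, ∑ v, h * (w u v * |f u ^ 2 - f v ^ 2|) ≤
      ∑ u, ∑ v, (w u v * (f u - f v) ^ 2 + h ^ 2 / 2 * (w u v * f u ^ 2) +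
        h ^ 2 / 2 * (w u v * f v ^ 2)) := by
    refine Finset.sum_le_sum fun u _ => Finset.sum_le_sum fun v _ => ?_
    -- AM–GM on `|f u - f v| · h(f u + f v)`. Summed and combined with the co-area inequality for
    -- `f²`, it leaves `2h²k - h²k = h²k`.
    have h3 : h * |f u ^ 2 - f v ^ 2| ≤
        (f u - f v) ^ 2 + h ^ 2 / 2 * f u ^ 2 + h ^ 2 / 2 * f v ^ 2 := by
      have : |f u ^ 2 - f v ^ 2| = |f u - f v| * (f u + f v) := by
        rw [show f u ^ 2 - f v ^ 2 = (f u - f v) * (f u + f v) by ring, abs_mul,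
          abs_of_nonneg (add_nonneg (hf u) (hf v))]
      rw [this, ← sq_abs (f u - f v)]
      nlinarith [sq_nonneg (|f u - f v| - h / 2 * (f u + f v)), sq_nonneg (h * (f u - f v))]
    nlinarith [mul_le_mul_of_nonneg_left h3 (hw0 u v)]
  simp only [Finset.sum_add_distrib, ← Finset.mul_sum] at h2
  rw [sum_row_sq hreg, sum_col_sq hw hreg] at h2
  unfold dirichlet
  nlinarith [mul_le_mul_of_nonneg_left h1 hh.le]

/-- Take the least value with at most half of the points strictly above it. If more than half were
below, the largest value below would also qualify, against minimality. -/
theorem exists_median [Nonempty W] (x : W → ℝ) :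
    ∃ m : ℝ, 2 * (Finset.univ.filter fun u => m < x u).card ≤ Fintype.card W ∧
      2 * (Finset.univ.filter fun u => x u < m).card ≤ Fintype.card W := by
  classical
  set P := Finset.univ.filter fun w =>
    2 * (Finset.univ.filter fun u => x w < x u).card ≤ Fintype.card W with hP
  have hne : P.Nonempty := by
    obtain ⟨t, -, ht⟩ := Finset.exists_max_image Finset.univ x Finset.univ_nonempty
    refine ⟨t, ?_⟩
    have : (Finset.univ.filter fun u => x t < x u) = ∅ := by
      ext u; simpa using ht u (Finset.mem_univ u)
    simp [hP, this]
  obtain ⟨t, htP, hmin⟩ := P.exists_min_image x hne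
  refine ⟨x t, by simpa [hP] using htP, ?_⟩
  by_contra! hcon
  have hne' : (Finset.univ.filter fun u => x u < x t).Nonempty := by
    rw [← Finset.card_pos]; omega
  obtain ⟨s, hs, hmax⟩ := Finset.exists_max_image _ x hne'
  have hst : x s < x t := by simpa using hs
  have hsP : s ∉ P := fun h => absurd (hmin s h) (not_le.2 hst)
  have hsub : (Finset.univ.filter fun u => x s < x u) ⊆
      Finset.univ.filter fun u => ¬ x u < x t := by
    intro u hu
    simp only [Finset.mem_filter, Finset.mem_univ, true_and] at hu ⊢
    intro h
    exact absurd (hmax u (by simpa using h)) (not_le.2 hu)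
  have h1 := Finset.card_le_card hsub
  have h2 := Finset.card_filter_add_card_filter_not (s := (Finset.univ : Finset W))
    (fun u => x u < x t)
  rw [Finset.card_univ] at h2
  have h3 : ¬ 2 * (Finset.univ.filter fun u => x s < x u).card ≤ Fintype.card W := by
    simpa [hP] using hsP
  omega

/-- The discrete **Cheeger inequality**: edge expansion `h` of a `k`-regular weighted graph yields
the bound `(1 - h ^ 2 / 2) k` for its quadratic form on functions of mean zero. -/
theorem cheeger [DecidableEq W] {w : W → W → ℝ} (hw : ∀ u v, w u v = w v u)
    (hw0 : ∀ u v, 0 ≤ w u v) {k h : ℝ} (hk : 0 ≤ k) (hh : 0 < h) (hreg : ∀ u, ∑ v, w u v = k)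
    (hexp : ∀ F : Finset W, 2 * F.card ≤ Fintype.card W → h * k * F.card ≤ cutWeight w F)
    (x : W → ℝ) (hx : ∑ u, x u = 0) :
    quadForm w x ≤ (1 - h ^ 2 / 2) * k * ∑ u, x u ^ 2 := by
  rcases isEmpty_or_nonempty W with hW | hW
  · simp [quadForm]
  obtain ⟨m, hm1, hm2⟩ := exists_median x
  have hp := dirichlet_ge_of_small_support hw hw0 hh hreg hexp (fun u => max (x u - m) 0)
    (fun u => le_max_right _ _) (by simpa using hm1)
  have hn := dirichlet_ge_of_small_support hw hw0 hh hreg hexp (fun u => max (m - x u) 0)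
    (fun u => le_max_right _ _) (by simpa using hm2)
  -- Splitting `x - m` into positive and negative parts does not raise the energy: across the
  -- median, the square of a sum of nonnegative numbers dominates the sum of squares.
  have hD : dirichlet w (fun u => max (x u - m) 0) + dirichlet w (fun u => max (m - x u) 0) ≤
      dirichlet w x := by
    simp only [dirichlet, ← Finset.sum_add_distrib]
    refine Finset.sum_le_sum fun u _ => Finset.sum_le_sum fun v _ => ?_
    rw [← mul_add]
    refine mul_le_mul_of_nonneg_left ?_ (hw0 u v)
    rcases le_total (x u) m with hu | hu <;> rcases le_total (x v) m with hv | hv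
    · rw [max_eq_right (by linarith), max_eq_right (by linarith), max_eq_left (by linarith),
        max_eq_left (by linarith)]; nlinarith
    · rw [max_eq_right (by linarith), max_eq_left (by linarith), max_eq_left (by linarith),
        max_eq_right (by linarith)]; nlinarith
    · rw [max_eq_left (by linarith), max_eq_right (by linarith), max_eq_right (by linarith),
        max_eq_left (by linarith)]; nlinarith
    · rw [max_eq_left (by linarith), max_eq_left (by linarith), max_eq_right (by linarith),
        max_eq_right (by linarith)]; nlinarith
  -- The right side is `∑ (x - m)²`, and a mean-zero `x` has the smallest norm among its translates
  -- by constants.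
  have hS : ∑ u, x u ^ 2 ≤ ∑ u, max (x u - m) 0 ^ 2 + ∑ u, max (m - x u) 0 ^ 2 := by
    have h1 : ∀ u, max (x u - m) 0 ^ 2 + max (m - x u) 0 ^ 2 = x u ^ 2 - 2 * m * x u + m ^ 2 := by
      intro u
      rcases le_total (x u) m with hu | hu
      · rw [max_eq_right (by linarith), max_eq_left (by linarith)]; ring
      · rw [max_eq_left (by linarith), max_eq_right (by linarith)]; ring
    rw [← Finset.sum_add_distrib]
    simp only [h1, Finset.sum_add_distrib, Finset.sum_sub_distrib, ← Finset.mul_sum, hx]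
    have : (0 : ℝ) ≤ ∑ _u : W, m ^ 2 := Finset.sum_nonneg fun _ _ => sq_nonneg m
    linarith
  rw [dirichlet_eq hw hreg x] at hD
  have := mul_le_mul_of_nonneg_left hS (mul_nonneg (sq_nonneg h) hk)
  nlinarith

end Cheeger

/-! ### Cuts of the underlying graph -/

namespace AbstractSimplicialComplex

variable {V : Type*} [Fintype V]

theorem mem_edges {X : AbstractSimplicialComplex V} {s : Finset V} :
    s ∈ X.edges ↔ s ∈ X.faces ∧ s.card = 2 := by
  simp [edges]

theorem mem_triangles {X : AbstractSimplicialComplex V} {s : Finset V} :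
    s ∈ X.triangles ↔ s ∈ X.faces ∧ s.card = 3 := by
  simp [triangles]

theorem mem_edges_of_subset {X : AbstractSimplicialComplex V} {t e : Finset V}
    (ht : t ∈ X.triangles) (het : e ⊆ t) (he : e.card = 2) : e ∈ X.edges :=
  mem_edges.2 ⟨(X.isRelLowerSet_faces (mem_triangles.1 ht).1).2 het
    (Finset.card_pos.1 (by omega)), he⟩

variable [DecidableEq V]

theorem mem_coboundary₀ {X : AbstractSimplicialComplex V} {R : Finset V} {e : Finset V} :
    e ∈ X.coboundary₀ R ↔ ∃ u ∈ R, ∃ v ∉ R, X.underlyingGraph.Adj u v ∧ e = {u, v} := by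
  simp only [coboundary₀, Finset.mem_filter, underlyingGraph]
  constructor
  · rintro ⟨he, h⟩
    obtain ⟨x, y, hxy, rfl⟩ := Finset.card_eq_two.1 (X.card_edge e he)
    by_cases hx : x ∈ R <;> by_cases hy : y ∈ R
    · rw [Finset.inter_eq_left.2 (by intro z; simp; rintro (rfl | rfl) <;> assumption)] at h
      rw [X.card_edge _ he] at h
      omega
    · exact ⟨x, hx, y, hy, he, rfl⟩
    · exact ⟨y, hy, x, hx, by rwa [Finset.pair_comm], Finset.pair_comm _ _⟩
    · rw [Finset.card_eq_one] at h
      obtain ⟨z, hz⟩ := h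
      have : z ∈ ({x, y} : Finset V) ∩ R := by simp [hz]
      simp only [Finset.mem_inter, Finset.mem_insert, Finset.mem_singleton] at this
      obtain ⟨rfl | rfl, h⟩ := this <;> contradiction
  · rintro ⟨u, hu, v, hv, h, rfl⟩
    refine ⟨h, ?_⟩
    rw [Finset.card_eq_one]
    refine ⟨u, ?_⟩
    ext z
    simp only [Finset.mem_inter, Finset.mem_insert, Finset.mem_singleton]
    constructor
    · rintro ⟨rfl | rfl, h⟩
      · rfl
      · contradiction
    · rintro rfl
      exact ⟨Or.inl rfl, hu⟩

theorem coboundary₀_compl (X : AbstractSimplicialComplex V) (R : Finset V) :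
    X.coboundary₀ Rᶜ = X.coboundary₀ R := by
  ext e
  simp only [mem_coboundary₀, Finset.mem_compl, not_not]
  constructor <;> rintro ⟨u, hu, v, hv, h, rfl⟩ <;>
    exact ⟨v, hv, u, hu, h.symm, Finset.pair_comm _ _⟩

theorem sum_kernel_underlyingGraph {X : AbstractSimplicialComplex V} {k₀ k₁ : ℕ}
    (hreg : X.IsRegular k₀ k₁) (u : V) : ∑ v, X.underlyingGraph.kernel u v = k₀ := by
  classical
  simp only [SimpleGraph.kernel_eq_ite, Finset.sum_boole]
  rw [← hreg.1 u]
  congr 1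
  refine Finset.card_bij (fun v _ => {u, v}) ?_ ?_ ?_
  · intro v hv
    exact Finset.mem_filter.2 ⟨(Finset.mem_filter.1 hv).2, by simp⟩
  · intro v hv v' hv' h
    simp only [Finset.mem_filter, Finset.mem_univ, true_and] at hv hv'
    have h1 : v ∈ ({u, v'} : Finset V) := by rw [← h]; simp
    rcases Finset.mem_insert.1 h1 with h2 | h2
    · exact absurd h2 hv.ne'
    · simpa using h2
  · intro e he
    simp only [Finset.mem_filter] at he
    obtain ⟨x, y, hxy, rfl⟩ := Finset.card_eq_two.1 (X.card_edge e he.1)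
    have hu := he.2
    simp only [Finset.mem_insert, Finset.mem_singleton] at hu
    rcases hu with rfl | rfl
    · exact ⟨y, Finset.mem_filter.2 ⟨Finset.mem_univ _, he.1⟩, rfl⟩
    · exact ⟨x, Finset.mem_filter.2 ⟨Finset.mem_univ _, (show X.underlyingGraph.Adj x u from he.1).symm⟩,
        Finset.pair_comm _ _⟩

theorem cutWeight_underlyingGraph (X : AbstractSimplicialComplex V) (R : Finset V) :
    cutWeight X.underlyingGraph.kernel R = (X.coboundary₀ R).card := by
  classical
  simp only [cutWeight, SimpleGraph.kernel_eq_ite]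
  rw [← Finset.sum_product', Finset.sum_boole]
  congr 1
  refine Finset.card_bij (fun p _ => {p.1, p.2}) ?_ ?_ ?_
  · rintro ⟨u, v⟩ h
    simp only [Finset.mem_filter, Finset.mem_product, Finset.mem_compl] at h
    exact mem_coboundary₀.2 ⟨u, h.1.1, v, h.1.2, h.2, rfl⟩
  · rintro ⟨u, v⟩ h ⟨u', v'⟩ h' heq
    simp only [Finset.mem_filter, Finset.mem_product, Finset.mem_compl] at h h' heq
    have hu : u ∈ ({u', v'} : Finset V) := by rw [← heq]; simp
    have hv : v ∈ ({u', v'} : Finset V) := by rw [← heq]; simp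
    simp only [Finset.mem_insert, Finset.mem_singleton] at hu hv
    rcases hu with rfl | rfl
    · rcases hv with rfl | rfl
      · exact absurd h.1.1 h.1.2
      · rfl
    · exact absurd h.1.1 h'.1.2
  · intro e he
    obtain ⟨u, hu, v, hv, h, rfl⟩ := mem_coboundary₀.1 he
    exact ⟨(u, v), by simp [hu, hv, h], rfl⟩

theorem sum_card_star {X : AbstractSimplicialComplex V} {F : Finset (Finset V)}
    (hF : F ⊆ X.edges) : ∑ v, (F.filter (v ∈ ·)).card = 2 * F.card := by
  simp only [Finset.card_filter]
  rw [Finset.sum_comm, Finset.sum_const_nat (m := 2), mul_comm]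
  intro e he
  rw [← Finset.card_filter, Finset.filter_univ_mem, X.card_edge e (hF he)]

/-- The spectral lower bound on the size of a cut. -/
theorem le_card_coboundary₀ {X : AbstractSimplicialComplex V} {k₀ k₁ : ℕ}
    (hreg : X.IsRegular k₀ k₁) (hk₀ : 0 < k₀)
    (hlt : normalizedSecondEigenvalue X.underlyingGraph k₀ < 1) (R : Finset V) :
    (1 - normalizedSecondEigenvalue X.underlyingGraph k₀) * k₀ *
      (R.card * (Fintype.card V - R.card)) ≤ Fintype.card V * (X.coboundary₀ R).card := by
  have hk : (0 : ℝ) < k₀ := by exact_mod_cast hk₀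
  rcases isEmpty_or_nonempty V with hV | hV
  · have : R.card = 0 := by simp [Finset.eq_empty_of_isEmpty R]
    simp [this]
  have hn : (0 : ℝ) < Fintype.card V := by exact_mod_cast Fintype.card_pos
  set n : ℝ := (Fintype.card V : ℝ) with hn_def
  set lam := normalizedSecondEigenvalue X.underlyingGraph k₀ with hlam
  have hl : adjEigenvalue X.underlyingGraph 1 = lam * k₀ := by
    rw [hlam, normalizedSecondEigenvalue]; field_simp
  set w := X.underlyingGraph.kernel
  -- The test function is the indicator of `R` projected to mean zero; the shift does not change its
  -- Dirichlet energy.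
  set x : V → ℝ := fun u => (if u ∈ R then 1 else 0) - R.card / n with hx
  have hsum : ∑ u, x u = 0 := by
    simp only [hx, Finset.sum_sub_distrib, Finset.sum_boole, Finset.filter_univ_mem,
      Finset.sum_const, Finset.card_univ, nsmul_eq_mul]
    rw [← hn_def]; field_simp; ring
  have hsq : n * ∑ u, x u ^ 2 = R.card * (n - R.card) := by
    have h : ∀ u, x u ^ 2 = (if u ∈ R then 1 else 0) * (1 - 2 * (R.card / n)) +
        (R.card / n) ^ 2 := by
      intro u; simp only [hx]; split_ifs <;> ring
    simp only [h, Finset.sum_add_distrib, ← Finset.sum_mul, Finset.sum_boole,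
      Finset.filter_univ_mem, Finset.sum_const, Finset.card_univ, nsmul_eq_mul]
    rw [← hn_def]; field_simp; ring
  have hdir : dirichlet w x = 2 * cutWeight w R := by
    rw [← sum_abs_indicator_sub X.underlyingGraph.kernel_symm]
    refine Finset.sum_congr rfl fun u _ => Finset.sum_congr rfl fun v _ => ?_
    congr 1
    simp only [hx, sub_sub_sub_cancel_right]
    split_ifs <;> norm_num
  have hq := quadForm_le_secondEigenvalue X.underlyingGraph (sum_kernel_underlyingGraph hreg)
    (by rw [hl]; nlinarith) x hsum
  rw [dirichlet_eq X.underlyingGraph.kernel_symm (sum_kernel_underlyingGraph hreg),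
    cutWeight_underlyingGraph] at hdir
  rw [hl] at hq
  rw [← hsq]
  nlinarith

/-- A vertex of `R` has at most `|R| - 1` neighbours inside `R`. This serves small `R`, where the
spectral bound may be too weak. -/
theorem card_mul_le_card_coboundary₀ {X : AbstractSimplicialComplex V} {k₀ k₁ : ℕ}
    (hreg : X.IsRegular k₀ k₁) (R : Finset V) :
    (R.card : ℝ) * (k₀ - (R.card - 1)) ≤ (X.coboundary₀ R).card := by
  rw [← cutWeight_underlyingGraph, cutWeight, ← nsmul_eq_mul]
  refine Finset.card_nsmul_le_sum _ _ _ fun u hu => ?_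
  have h1 := Finset.sum_add_sum_compl R (X.underlyingGraph.kernel u)
  rw [sum_kernel_underlyingGraph hreg] at h1
  have h2 : ∑ v ∈ R, X.underlyingGraph.kernel u v ≤ (R.card : ℝ) - 1 := by
    classical
    rw [← Finset.add_sum_erase R _ hu]
    have h3 : ∑ v ∈ R.erase u, X.underlyingGraph.kernel u v ≤ (R.erase u).card • (1 : ℝ) := by
      refine Finset.sum_le_card_nsmul _ _ _ fun v _ => ?_
      rw [SimpleGraph.kernel_eq_ite]
      split_ifs <;> norm_num
    rw [Finset.card_erase_of_mem hu, nsmul_eq_mul, mul_one,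
      Nat.cast_sub (Finset.card_pos.2 ⟨u, hu⟩)] at h3
    have h4 : X.underlyingGraph.kernel u u = 0 := by simp [SimpleGraph.kernel_eq_ite]
    rw [h4]
    push_cast at h3
    linarith
  linarith

/-- If the normalized second eigenvalue is less than `1 / 2` then every nontrivial cut has at
least as many edges as the cut of a single vertex. -/
theorem degree_le_card_coboundary₀ {X : AbstractSimplicialComplex V} {k₀ k₁ : ℕ}
    (hreg : X.IsRegular k₀ k₁) (hk₀ : 2 ≤ k₀)
    (hlt : normalizedSecondEigenvalue X.underlyingGraph k₀ < 1 / 2) (R : Finset V)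
    (hne : R ≠ ∅) (hne' : R ≠ Finset.univ) : k₀ ≤ (X.coboundary₀ R).card := by
  have hn : 0 < Fintype.card V :=
    let ⟨v, _⟩ := Finset.nonempty_iff_ne_empty.2 hne; Fintype.card_pos_iff.2 ⟨v⟩
  have main : ∀ R : Finset V, R ≠ ∅ → 2 * R.card ≤ Fintype.card V →
      k₀ ≤ (X.coboundary₀ R).card := by
    intro R hR hcard
    have hr : 1 ≤ R.card := Finset.card_pos.2 (Finset.nonempty_iff_ne_empty.2 hR)
    have hr' : (1 : ℝ) ≤ R.card := by exact_mod_cast hr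
    have hk : (2 : ℝ) ≤ k₀ := by exact_mod_cast hk₀
    rcases le_or_gt R.card k₀ with h | h
    · have h1 := card_mul_le_card_coboundary₀ hreg R
      have h' : (R.card : ℝ) ≤ k₀ := by exact_mod_cast h
      -- `r(k₀ - r + 1)` is concave in `r` and equals `k₀` at both ends `r = 1` and `r = k₀`.
      have h2 : (k₀ : ℝ) ≤ (X.coboundary₀ R).card := by nlinarith
      exact_mod_cast h2
    · have h1 := le_card_coboundary₀ hreg (by omega) (by linarith) R
      set lam := normalizedSecondEigenvalue X.underlyingGraph k₀
      have hn' : (0 : ℝ) < Fintype.card V := by exact_mod_cast hn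
      have hc : 2 * (R.card : ℝ) ≤ Fintype.card V := by exact_mod_cast hcard
      have h2 : (1 / 2 : ℝ) * k₀ * (R.card * (Fintype.card V / 2)) <
          Fintype.card V * (X.coboundary₀ R).card := by
        refine lt_of_lt_of_le ?_ h1
        have h3 : (R.card : ℝ) * (Fintype.card V / 2) ≤
            R.card * (Fintype.card V - R.card) := by
          apply mul_le_mul_of_nonneg_left <;> linarith
        have h4 : 0 < (R.card : ℝ) * (Fintype.card V / 2) := by positivity
        calc (1 / 2 : ℝ) * k₀ * (R.card * (Fintype.card V / 2))
            < (1 - lam) * k₀ * (R.card * (Fintype.card V / 2)) := by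
              apply mul_lt_mul_of_pos_right _ h4
              apply mul_lt_mul_of_pos_right <;> linarith
          _ ≤ _ := by
              apply mul_le_mul_of_nonneg_left h3
              apply mul_nonneg <;> linarith
      have h3 : (k₀ : ℝ) * R.card < 4 * (X.coboundary₀ R).card := by
        by_contra! hcon
        nlinarith
      have h4 : k₀ * R.card < 4 * (X.coboundary₀ R).card := by exact_mod_cast h3
      by_contra! hcon
      -- The strict bound `k₀ r < 4|δ(R)|` suffices for `r ≥ 4`. As `r > k₀ ≥ 2`, only `k₀ = 2`, `r
      -- = 3` is left, where integrality gives two edges.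
      rcases le_or_gt 4 R.card with h5 | h5
      · nlinarith
      · have h6 : k₀ = 2 := by omega
        have h7 : R.card = 3 := by omega
        rw [h6] at hcon h4
        omega
  rcases le_total (2 * R.card) (Fintype.card V) with h | h
  · exact main R hne h
  · rw [← coboundary₀_compl]
    refine main _ ?_ ?_
    · rwa [ne_eq, Finset.compl_eq_empty_iff]
    · rw [Finset.card_compl]
      have := R.card_le_univ
      omega

end AbstractSimplicialComplex

/-! ### Cocycles and the coboundaries of stars -/

namespace AbstractSimplicialComplex

variable {V : Type*} [Fintype V] {X : AbstractSimplicialComplex V} {k₀ k₁ : ℕ}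

theorem exists_triangle (hdim : X.IsTwoDimensional) : ∃ t, t ∈ X.triangles :=
  let ⟨t, ht, h⟩ := hdim.2; ⟨t, mem_triangles.2 ⟨ht, h⟩⟩

theorem exists_edge (hdim : X.IsTwoDimensional) : ∃ e, e ∈ X.edges := by
  obtain ⟨t, ht⟩ := exists_triangle hdim
  obtain ⟨e, he, hc⟩ := Finset.exists_subset_card_eq (s := t) (n := 2)
    (by rw [X.card_triangle t ht]; omega)
  exact ⟨e, mem_edges_of_subset ht he hc⟩

theorem three_le_card (hdim : X.IsTwoDimensional) : 3 ≤ Fintype.card V := by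
  obtain ⟨t, ht⟩ := exists_triangle hdim
  rw [← X.card_triangle t ht]
  exact t.card_le_univ

variable [DecidableEq V]

theorem two_le_degree (hdim : X.IsTwoDimensional) (hreg : X.IsRegular k₀ k₁) : 2 ≤ k₀ := by
  obtain ⟨t, ht⟩ := exists_triangle hdim
  obtain ⟨a, b, c, hab, hac, hbc, rfl⟩ := Finset.card_eq_three.1 (X.card_triangle t ht)
  rw [← hreg.1 a]
  have h : ({{a, b}, {a, c}} : Finset (Finset V)) ⊆ X.edges.filter (a ∈ ·) := by
    intro e he
    simp only [Finset.mem_insert, Finset.mem_singleton] at he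
    rcases he with rfl | rfl
    · exact Finset.mem_filter.2 ⟨mem_edges_of_subset ht (by
        intro z; simp; tauto) (Finset.card_pair hab), by simp⟩
    · exact Finset.mem_filter.2 ⟨mem_edges_of_subset ht (by
        intro z; simp; tauto) (Finset.card_pair hac), by simp⟩
  refine le_trans ?_ (Finset.card_le_card h)
  rw [Finset.card_pair]
  intro heq
  have : b ∈ ({a, c} : Finset V) := by rw [← heq]; simp
  simp only [Finset.mem_insert, Finset.mem_singleton] at this
  rcases this with h | h
  · exact hab h.symm
  · exact hbc h

theorem one_le_edge_degree (hdim : X.IsTwoDimensional) (hreg : X.IsRegular k₀ k₁) : 1 ≤ k₁ := by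
  obtain ⟨t, ht⟩ := exists_triangle hdim
  obtain ⟨e, he, hc⟩ := Finset.exists_subset_card_eq (s := t) (n := 2)
    (by rw [X.card_triangle t ht]; omega)
  rw [← hreg.2 e (mem_edges_of_subset ht he hc)]
  exact Finset.card_pos.2 ⟨t, Finset.mem_filter.2 ⟨ht, he⟩⟩

theorem two_mul_card_edges (hreg : X.IsRegular k₀ k₁) :
    2 * X.edges.card = Fintype.card V * k₀ := by
  rw [← sum_card_star (F := X.edges) (fun _ h => h), Finset.sum_const_nat (fun v _ => hreg.1 v),
    Finset.card_univ]

/-- Under the hypotheses of the main theorem every nonempty `1`-cocycle has at least `k₀` edges. -/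
theorem eq_empty_or_degree_le_card_of_mem_cocycles₁ (hreg : X.IsRegular k₀ k₁) (hk₀ : 2 ≤ k₀)
    {ε μ : ℝ} (hcos : X.IsCosystolicExpander k₀ k₁ ε μ)
    (hlt : normalizedSecondEigenvalue X.underlyingGraph k₀ < 1 / 2)
    (hlarge : 3 / μ ≤ (Fintype.card V : ℝ)) {Z : Finset (Finset V)} (hZ : Z ∈ X.cocycles₁) :
    Z = ∅ ∨ k₀ ≤ Z.card := by
  obtain ⟨-, hμ, -, h⟩ := hcos
  rcases (h Z hZ.1).1 hZ.2 with ⟨R, rfl⟩ | hbig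
  · by_cases h0 : R = ∅
    · left; ext e; simp [mem_coboundary₀, h0]
    by_cases h1 : R = Finset.univ
    · left; ext e; simp [mem_coboundary₀, h1]
    exact Or.inr (degree_le_card_coboundary₀ hreg hk₀ hlt R h0 h1)
  · right
    have h2 : (2 : ℝ) * X.edges.card = Fintype.card V * k₀ := by
      exact_mod_cast two_mul_card_edges hreg
    have h3 : 3 ≤ Fintype.card V * μ := (div_le_iff₀ hμ).1 hlarge
    have hk : (2 : ℝ) ≤ k₀ := by exact_mod_cast hk₀
    -- `μ|E| = μ|V|k₀/2 ≥ 3k₀/2`.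
    have h4 : (k₀ : ℝ) ≤ Z.card := by nlinarith
    exact_mod_cast h4

/-- The empty cocycle is at distance `|F|`, and any other has at least `k₀ - |F|` edges outside `F`.
The subtraction is truncated, so the bound is void once `|F| ≥ k₀`. -/
theorem min_le_setDist_cocycles₁
    (hZ : ∀ Z ∈ X.cocycles₁, Z = ∅ ∨ k₀ ≤ Z.card) (F : Finset (Finset V)) :
    min F.card (k₀ - F.card) ≤ setDist F X.cocycles₁ := by
  have hne : X.cocycles₁.Nonempty := ⟨∅, by simp [cocycles₁, coboundary₁]⟩
  obtain ⟨Z, hZm, hd⟩ := Nat.sInf_mem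
    (hne.image fun T : Finset (Finset V) => (F \ T).card + (T \ F).card)
  rw [setDist, ← hd]
  rcases hZ Z hZm with rfl | h
  · simp
  · have := Finset.le_card_sdiff F Z
    simp only
    omega

/-- Cosystolic expansion of a set of edges, in terms of its size alone. -/
theorem mul_min_le_card_coboundary₁ {ε μ : ℝ} (hcos : X.IsCosystolicExpander k₀ k₁ ε μ)
    (hZ : ∀ Z ∈ X.cocycles₁, Z = ∅ ∨ k₀ ≤ Z.card) {F : Finset (Finset V)} (hF : F ⊆ X.edges) :
    ε * k₁ * (min F.card (k₀ - F.card) : ℕ) ≤ ((X.coboundary₁ F).card : ℝ) := by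
  have hmin := min_le_setDist_cocycles₁ hZ F
  obtain ⟨hε, -, -, h⟩ := hcos
  -- If `F` is itself a cocycle, its distance is 0, which forces the minimum to vanish as well.
  by_cases h0 : (X.coboundary₁ F).card = 0
  · have hle : setDist F X.cocycles₁ ≤ 0 :=
      Nat.sInf_le ⟨F, ⟨hF, h0⟩, by simp⟩
    rw [Nat.le_zero.1 (hmin.trans hle), h0]
    simp
  · refine le_trans ?_ ((h F hF).2 h0)
    have : ((min F.card (k₀ - F.card) : ℕ) : ℝ) ≤ setDist F X.cocycles₁ := by exact_mod_cast hmin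
    exact mul_le_mul_of_nonneg_left this (by positivity)

/-- Test the expansion on a single edge, whose coboundary lies among its `k₁` triangles. The bound
is what keeps `α` above `1/2`. -/
theorem eps_le_one (hdim : X.IsTwoDimensional) (hreg : X.IsRegular k₀ k₁)
    {ε μ : ℝ} (hcos : X.IsCosystolicExpander k₀ k₁ ε μ)
    (hZ : ∀ Z ∈ X.cocycles₁, Z = ∅ ∨ k₀ ≤ Z.card) : ε ≤ 1 := by
  obtain ⟨e, he⟩ := exists_edge hdim
  have hk₀ := two_le_degree hdim hreg
  have hk₁ : (1 : ℝ) ≤ k₁ := by exact_mod_cast one_le_edge_degree hdim hreg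
  have h := mul_min_le_card_coboundary₁ hcos hZ (Finset.singleton_subset_iff.2 he)
  have hcard : (X.coboundary₁ {e}).card ≤ k₁ := by
    rw [← hreg.2 e he]
    refine Finset.card_le_card fun t ht => ?_
    simp only [coboundary₁, Finset.mem_filter] at ht ⊢
    refine ⟨ht.1, ?_⟩
    by_contra hcon
    simp [Finset.filter_singleton, hcon] at ht
  have hcard' : ((X.coboundary₁ {e}).card : ℝ) ≤ k₁ := by exact_mod_cast hcard
  rw [Finset.card_singleton, min_eq_left (by omega)] at h
  push_cast at h
  nlinarith

/-- Each triangle is in the coboundary of at most as many of the stars of `F` as it has pairs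
consisting of an edge in `F` and an edge outside `F`. -/
theorem card_odd_stars_le {t : Finset V} (ht : t ∈ X.triangles) {F : Finset (Finset V)}
    (hF : F ⊆ X.edges) :
    (Finset.univ.filter fun v => Odd ((F.filter (v ∈ ·)).filter (· ⊆ t)).card).card ≤
      (F.filter (· ⊆ t)).card * (3 - (F.filter (· ⊆ t)).card) := by
  obtain ⟨a, b, c, hab, hac, hbc, rfl⟩ := Finset.card_eq_three.1 (X.card_triangle t ht)
  have h1 : ({a, b} : Finset V) ≠ {a, c} := fun h => by
    have : b ∈ ({a, c} : Finset V) := by rw [← h]; simp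
    simp [hab.symm, hbc] at this
  have h2 : ({a, b} : Finset V) ≠ {b, c} := fun h => by
    have : a ∈ ({b, c} : Finset V) := by rw [← h]; simp
    simp [hab, hac] at this
  have h3 : ({a, c} : Finset V) ≠ {b, c} := fun h => by
    have : a ∈ ({b, c} : Finset V) := by rw [← h]; simp
    simp [hab, hac] at this
  have hG : F.filter (· ⊆ {a, b, c}) =
      ({{a, b}, {a, c}, {b, c}} : Finset (Finset V)).filter (· ∈ F) := by
    ext e
    simp only [Finset.mem_filter]
    rw [and_comm]
    refine and_congr_left fun he => ⟨fun hs => ?_, fun hs => ?_⟩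
    · have hc := X.card_edge e (hF he)
      obtain ⟨x, y, hxy, rfl⟩ := Finset.card_eq_two.1 hc
      have hx : x ∈ ({a, b, c} : Finset V) := hs (by simp)
      have hy : y ∈ ({a, b, c} : Finset V) := hs (by simp)
      simp only [Finset.mem_insert, Finset.mem_singleton] at hx hy ⊢
      rcases hx with rfl | rfl | rfl <;> rcases hy with rfl | rfl | rfl <;>
        simp_all [Finset.pair_comm]
    · simp only [Finset.mem_insert, Finset.mem_singleton] at hs
      rcases hs with rfl | rfl | rfl <;> intro z <;> simp <;> tauto
  have hsub : (Finset.univ.filter fun v =>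
      Odd ((F.filter (v ∈ ·)).filter (· ⊆ ({a, b, c} : Finset V))).card) =
      ({a, b, c} : Finset V).filter fun v =>
        Odd ((({{a, b}, {a, c}, {b, c}} : Finset (Finset V)).filter (· ∈ F)).filter
          (v ∈ ·)).card := by
    ext v
    rw [Finset.mem_filter, Finset.mem_filter, Finset.filter_comm, hG]
    refine ⟨fun h => ⟨?_, h.2⟩, fun h => ⟨Finset.mem_univ v, h.2⟩⟩
    obtain ⟨e, he⟩ := Finset.card_pos.1 h.2.pos
    simp only [Finset.mem_filter, Finset.mem_insert, Finset.mem_singleton] at he ⊢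
    rcases he.1.1 with rfl | rfl | rfl <;> have := he.2 <;> simp at this <;> tauto
  rw [hsub, hG]
  -- With `j = 0, 1, 2, 3` edges in `F`, the vertices seeing exactly one of them number 0, 2, 2, 0,
  -- which is `j(3 - j)`.
  by_cases p : ({a, b} : Finset V) ∈ F <;> by_cases q : ({a, c} : Finset V) ∈ F <;>
    by_cases r : ({b, c} : Finset V) ∈ F <;>
    simp [Finset.filter_insert, Finset.filter_singleton, p, q, r, h1, h2, h3, hab, hac, hbc,
      hab.symm, hac.symm, hbc.symm, show ¬ Odd 2 by decide]

theorem sum_card_coboundary₁_star_le {F : Finset (Finset V)} (hF : F ⊆ X.edges) :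
    ∑ v, (X.coboundary₁ (F.filter (v ∈ ·))).card ≤
      ∑ t ∈ X.triangles, (F.filter (· ⊆ t)).card * (3 - (F.filter (· ⊆ t)).card) := by
  simp only [coboundary₁, Finset.card_filter _ X.triangles]
  rw [Finset.sum_comm]
  refine Finset.sum_le_sum fun t ht => ?_
  rw [← Finset.card_filter]
  exact card_odd_stars_le ht hF

end AbstractSimplicialComplex

/-! ### The edge-graph and its edge expansion -/

namespace AbstractSimplicialComplex

variable {V : Type*} [Fintype V] [DecidableEq V] {X : AbstractSimplicialComplex V} {k₀ k₁ : ℕ}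

/-- The incidence between triangles and edges. -/
def incidence (t e : Finset V) : ℝ := if e ⊆ t then 1 else 0

theorem subset_and_ne_iff {t : Finset V} (ht : t ∈ X.triangles) {e f : Finset V}
    (he : e ∈ X.edges) (hf : f ∈ X.edges) : (e ⊆ t ∧ f ⊆ t ∧ e ≠ f) ↔ t = e ∪ f := by
  have h3 := X.card_triangle t ht
  have he2 := X.card_edge e he
  have hf2 := X.card_edge f hf
  constructor
  · rintro ⟨h1, h2, hne⟩
    refine (Finset.eq_of_subset_of_card_le (Finset.union_subset h1 h2) ?_).symm
    by_contra! hcon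
    have h4 : (e ∪ f).card ≤ 2 := by omega
    have h5 := Finset.eq_of_subset_of_card_le (Finset.subset_union_left (s₁ := e) (s₂ := f))
      (by omega)
    have h6 := Finset.eq_of_subset_of_card_le (Finset.subset_union_right (s₁ := e) (s₂ := f))
      (by omega)
    exact hne (h5.trans h6.symm)
  · rintro rfl
    refine ⟨Finset.subset_union_left, Finset.subset_union_right, ?_⟩
    rintro rfl
    rw [Finset.union_self] at h3
    omega

theorem sum_incidence_triangles (hreg : X.IsRegular k₀ k₁) (e : X.Edge) :
    ∑ t ∈ X.triangles, incidence t e.1 = k₁ := by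
  simp only [incidence, Finset.sum_boole]
  rw [hreg.2 e.1 e.2]

theorem sum_incidence_edges {t : Finset V} (ht : t ∈ X.triangles) :
    ∑ e : X.Edge, incidence t e.1 = 3 := by
  rw [Finset.sum_coe_sort X.edges (fun e => incidence t e)]
  simp only [incidence, Finset.sum_boole]
  have h : X.edges.filter (· ⊆ t) = t.powersetCard 2 := by
    ext e
    rw [Finset.mem_filter, Finset.mem_powersetCard]
    exact ⟨fun h => ⟨h.2, X.card_edge e h.1⟩, fun h => ⟨mem_edges_of_subset ht h.1 h.2, h.1⟩⟩
  rw [h, Finset.card_powersetCard, X.card_triangle t ht]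
  norm_num [Nat.choose]

/-- The adjacency kernel of the edge graph in terms of incidences. -/
theorem kernel_edgeGraph (hreg : X.IsRegular k₀ k₁) (e f : X.Edge) :
    X.edgeGraph.kernel e f = ∑ t ∈ X.triangles, incidence t e.1 * incidence t f.1 -
      if e = f then (k₁ : ℝ) else 0 := by
  classical
  have h1 : (if e = f then (k₁ : ℝ) else 0) =
      ∑ t ∈ X.triangles, if e = f then incidence t e.1 else 0 := by
    rw [← sum_incidence_triangles hreg e]
    split_ifs <;> simp
  rw [h1, ← Finset.sum_sub_distrib, SimpleGraph.kernel_eq_ite]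
  -- Two distinct edges share at most one triangle, namely their union; the diagonal terms are what
  -- the subtraction removes.
  have h2 : ∀ t ∈ X.triangles, incidence t e.1 * incidence t f.1 -
      (if e = f then incidence t e.1 else 0) = if t = e.1 ∪ f.1 then 1 else 0 := by
    intro t ht
    simp only [← subset_and_ne_iff ht e.2 f.2, ne_eq, ← Subtype.ext_iff, incidence]
    by_cases hef : e = f
    · subst hef; by_cases he : e.1 ⊆ t <;> simp [he]
    · by_cases he : e.1 ⊆ t <;> by_cases hf : f.1 ⊆ t <;> simp [he, hf, hef]
  rw [Finset.sum_congr rfl h2, Finset.sum_ite_eq']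
  exact if_congr Iff.rfl rfl rfl

theorem sum_kernel_edgeGraph_mul (hreg : X.IsRegular k₀ k₁) (e : X.Edge) (s : Finset X.Edge)
    (x : X.Edge → ℝ) : ∑ f ∈ s, X.edgeGraph.kernel e f * x f =
      ∑ t ∈ X.triangles, incidence t e.1 * ∑ f ∈ s, incidence t f.1 * x f -
        if e ∈ s then k₁ * x e else 0 := by
  simp only [kernel_edgeGraph hreg, sub_mul, Finset.sum_sub_distrib, Finset.sum_mul, ite_mul,
    zero_mul, Finset.sum_ite_eq, Finset.mul_sum]
  rw [Finset.sum_comm]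
  simp only [mul_assoc]

theorem sum_kernel_edgeGraph (hreg : X.IsRegular k₀ k₁) (e : X.Edge) :
    ∑ f, X.edgeGraph.kernel e f = 2 * k₁ := by
  have h := sum_kernel_edgeGraph_mul hreg e Finset.univ fun _ => 1
  simp only [mul_one, Finset.mem_univ, if_true] at h
  rw [h, Finset.sum_congr rfl fun t ht => by rw [sum_incidence_edges ht], ← Finset.sum_mul,
    sum_incidence_triangles hreg]
  ring

/-- The identity `BᵀB - k₁ I` for the adjacency matrix; the square makes the lower spectral bound
`-k₁` immediate. -/
theorem quadForm_edgeGraph (hreg : X.IsRegular k₀ k₁) (x : X.Edge → ℝ) :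
    quadForm X.edgeGraph.kernel x =
      ∑ t ∈ X.triangles, (∑ e : X.Edge, incidence t e.1 * x e) ^ 2 - k₁ * ∑ e, x e ^ 2 := by
  rw [quadForm_eq]
  simp only [sum_kernel_edgeGraph_mul hreg, Finset.mem_univ, if_true, mul_sub,
    Finset.sum_sub_distrib, Finset.mul_sum (s := X.triangles)]
  rw [Finset.sum_comm]
  congr 1
  · refine Finset.sum_congr rfl fun t _ => ?_
    rw [sq, Finset.sum_mul]
    exact Finset.sum_congr rfl fun e _ => by ring
  · rw [Finset.mul_sum]
    exact Finset.sum_congr rfl fun e _ => by ring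

theorem neg_le_quadForm_edgeGraph (hreg : X.IsRegular k₀ k₁) (x : X.Edge → ℝ) :
    -(k₁ : ℝ) * ∑ e, x e ^ 2 ≤ quadForm X.edgeGraph.kernel x := by
  rw [quadForm_edgeGraph hreg]
  have : 0 ≤ ∑ t ∈ X.triangles, (∑ e : X.Edge, incidence t e.1 * x e) ^ 2 :=
    Finset.sum_nonneg fun _ _ => sq_nonneg _
  linarith

/-- Each boundary pair spans a unique triangle, so the boundary can be counted triangle by triangle.
-/
theorem cutWeight_edgeGraph (hreg : X.IsRegular k₀ k₁) (F : Finset X.Edge) :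
    cutWeight X.edgeGraph.kernel F =
      ∑ t ∈ X.triangles, (∑ e ∈ F, incidence t e.1) * (3 - ∑ e ∈ F, incidence t e.1) := by
  have h : ∀ e ∈ F, ∑ f ∈ Fᶜ, X.edgeGraph.kernel e f =
      ∑ t ∈ X.triangles, incidence t e.1 * ∑ f ∈ Fᶜ, incidence t f.1 := by
    intro e he
    have := sum_kernel_edgeGraph_mul hreg e Fᶜ fun _ => 1
    simpa [he] using this
  rw [cutWeight, Finset.sum_congr rfl h, Finset.sum_comm]
  refine Finset.sum_congr rfl fun t ht => ?_
  rw [← Finset.sum_mul]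
  congr 1
  rw [← sum_incidence_edges ht, ← Finset.sum_add_sum_compl F]
  ring

/-- The edge boundary of `F` in the edge graph dominates the coboundaries of its stars. -/
theorem sum_coboundary₁_le_cutWeight (hreg : X.IsRegular k₀ k₁) (F : Finset X.Edge) :
    ((∑ v, (X.coboundary₁ ((F.map (Function.Embedding.subtype _)).filter (v ∈ ·))).card : ℕ) : ℝ) ≤
      cutWeight X.edgeGraph.kernel F := by
  set F' : Finset (Finset V) := F.map (Function.Embedding.subtype _) with hF'
  have hsub : F' ⊆ X.edges := by
    intro e he
    obtain ⟨e', -, rfl⟩ := Finset.mem_map.1 he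
    exact e'.2
  have h : ((∑ v, (X.coboundary₁ (F'.filter (v ∈ ·))).card : ℕ) : ℝ) ≤
      (∑ t ∈ X.triangles, (F'.filter (· ⊆ t)).card * (3 - (F'.filter (· ⊆ t)).card) : ℕ) := by
    exact_mod_cast sum_card_coboundary₁_star_le hsub
  refine h.trans (le_of_eq ?_)
  rw [cutWeight_edgeGraph hreg]
  push_cast
  refine Finset.sum_congr rfl fun t ht => ?_
  have h1 : ∑ e ∈ F, incidence t e.1 = ((F'.filter (· ⊆ t)).card : ℝ) := by
    rw [hF', ← Finset.sum_boole, Finset.sum_map]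
    rfl
  have h2 : (F'.filter (· ⊆ t)).card ≤ 3 := by
    have : F'.filter (· ⊆ t) ⊆ t.powersetCard 2 := by
      intro e he
      rw [Finset.mem_filter] at he
      exact Finset.mem_powersetCard.2 ⟨he.2, X.card_edge e (hsub he.1)⟩
    refine (Finset.card_le_card this).trans ?_
    rw [Finset.card_powersetCard, X.card_triangle t ht]
    decide
  rw [h1, Nat.cast_sub h2]
  norm_num

theorem card_star_le (hreg : X.IsRegular k₀ k₁) {F : Finset (Finset V)} (hF : F ⊆ X.edges)
    (v : V) : (F.filter (v ∈ ·)).card ≤ k₀ := by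
  rw [← hreg.1 v]
  exact Finset.card_le_card (Finset.filter_subset_filter _ hF)

/-- The cut between the vertices where `F` is locally dense and those where it is locally sparse
consists of edges that are exceptional at one of their endpoints. -/
theorem card_coboundary₀_dense_le (hreg : X.IsRegular k₀ k₁) {F : Finset (Finset V)}
    (hF : F ⊆ X.edges) :
    (X.coboundary₀ (Finset.univ.filter fun v => k₀ < 2 * (F.filter (v ∈ ·)).card)).card ≤
      ∑ v, min (F.filter (v ∈ ·)).card (k₀ - (F.filter (v ∈ ·)).card) := by
  set A := Finset.univ.filter fun v => k₀ < 2 * (F.filter (v ∈ ·)).card with hA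
  -- `B v` is the minority at `v`, whose size is the minimum. A cut edge in `F` is in the minority
  -- at its sparse end, any other cut edge at its dense end.
  set B : V → Finset (Finset V) := fun v =>
    if v ∈ A then (X.edges \ F).filter (v ∈ ·) else F.filter (v ∈ ·) with hB
  have hsub : X.coboundary₀ A ⊆ Finset.univ.biUnion B := by
    intro e he
    obtain ⟨u, hu, v, hv, huv, rfl⟩ := mem_coboundary₀.1 he
    rw [Finset.mem_biUnion]
    by_cases h : ({u, v} : Finset V) ∈ F
    · exact ⟨v, Finset.mem_univ v, by simp only [hB, if_neg hv]; simp [h]⟩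
    · refine ⟨u, Finset.mem_univ u, ?_⟩
      simp only [hB, if_pos hu]
      rw [Finset.mem_filter, Finset.mem_sdiff]
      exact ⟨⟨huv, h⟩, by simp⟩
  refine (Finset.card_le_card hsub).trans (Finset.card_biUnion_le.trans
    (Finset.sum_le_sum fun v _ => ?_))
  have hle := card_star_le hreg hF v
  by_cases hv : v ∈ A
  · have h1 : k₀ < 2 * (F.filter (v ∈ ·)).card := by simpa [hA] using hv
    have h2 : ((X.edges \ F).filter (v ∈ ·)).card = k₀ - (F.filter (v ∈ ·)).card := by
      rw [← hreg.1 v, ← Finset.card_sdiff_of_subset (Finset.filter_subset_filter _ hF)]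
      congr 1
      ext e
      simp only [Finset.mem_filter, Finset.mem_sdiff]
      tauto
    simp only [hB, if_pos hv, h2]
    omega
  · have h1 : ¬ k₀ < 2 * (F.filter (v ∈ ·)).card := by simpa [hA] using hv
    simp only [hB, if_neg hv]
    omega

/-- Three ranges of `r`. For `r ≤ n/2` the cut controls `rk`, hence `S`. For `r ≥ 13n/20` the excess
`rk - S ≥ 3nk/20` already bounds `M`. In between, the cut is large because `r(n - r) ≥
(13/20)(7/20)n²`. -/
theorem local_imbalance_bound {n k L r S M : ℝ} (hn : 0 < n) (hk : 0 < k) (hL0 : 0 < L)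
    (hL : L ≤ 3 / 2) (hr : 0 ≤ r) (hcut : L * k * (r * (n - r)) ≤ n * M)
    (h1 : S ≤ M + r * k) (h2 : r * k ≤ S + M) (hS : 2 * S ≤ n * k) (hM : 0 ≤ M) :
    3 / 20 * L * S ≤ M := by
  have hLk : 0 < L * k := mul_pos hL0 hk
  rcases le_total (2 * r) n with h | h
  · have h3 : L * k * r / 2 ≤ M := by
      refine le_of_mul_le_mul_left (a := n) (le_trans ?_ hcut) hn
      have : 0 ≤ L * k * r * (n - 2 * r) := by
        apply mul_nonneg (by positivity); linarith
      nlinarith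
    nlinarith [mul_le_mul_of_nonneg_left h1 hL0.le, mul_le_mul_of_nonneg_right hL hM]
  · have h4 : L * S ≤ L * (n * k / 2) := mul_le_mul_of_nonneg_left (by linarith) hL0.le
    rcases le_total (13 / 20 * n) r with h3 | h3
    · have h5 : 13 / 20 * n * k ≤ r * k := mul_le_mul_of_nonneg_right h3 hk.le
      have h6 : L * (n * k / 2) ≤ 3 / 2 * (n * k / 2) :=
        mul_le_mul_of_nonneg_right hL (by positivity)
      nlinarith [mul_pos hn hk]
    · have h5 : 91 / 400 * n ^ 2 ≤ r * (n - r) := by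
        nlinarith [mul_nonneg (sub_nonneg.2 h) (sub_nonneg.2 h3)]
      have h6 : L * k * (91 / 400 * n) ≤ M := by
        refine le_of_mul_le_mul_left (a := n) (le_trans ?_ hcut) hn
        nlinarith [mul_le_mul_of_nonneg_left h5 hLk.le]
      nlinarith [mul_pos hLk hn]

/-- A set of at most half of the edges is locally imbalanced. -/
theorem card_le_sum_min (hreg : X.IsRegular k₀ k₁) (hk₀ : 2 ≤ k₀)
    (hn : 0 < Fintype.card V)
    (hlow : -(1 / 2) ≤ normalizedSecondEigenvalue X.underlyingGraph k₀)
    (hlt : normalizedSecondEigenvalue X.underlyingGraph k₀ < 1 / 2)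
    {F : Finset (Finset V)} (hF : F ⊆ X.edges) (hcard : 2 * F.card ≤ X.edges.card) :
    3 / 10 * (1 - normalizedSecondEigenvalue X.underlyingGraph k₀) * F.card ≤
      ((∑ v, min (F.filter (v ∈ ·)).card (k₀ - (F.filter (v ∈ ·)).card) : ℕ) : ℝ) := by
  set A := Finset.univ.filter fun v => k₀ < 2 * (F.filter (v ∈ ·)).card with hA
  set M := ∑ v, min (F.filter (v ∈ ·)).card (k₀ - (F.filter (v ∈ ·)).card) with hM
  have hmem : ∀ v, v ∈ A ↔ k₀ < 2 * (F.filter (v ∈ ·)).card := fun v => by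
    simp only [hA, Finset.mem_filter, Finset.mem_univ, true_and]
  have hcut := le_card_coboundary₀ hreg (by omega) (by linarith) A
  set lam := normalizedSecondEigenvalue X.underlyingGraph k₀
  have hAM : (X.coboundary₀ A).card ≤ M := card_coboundary₀_dense_le hreg hF
  have hsum := sum_card_star hF
  have hE := two_mul_card_edges hreg
  have hAk : A.card * k₀ = ∑ v, if v ∈ A then k₀ else 0 := by
    rw [Finset.sum_ite_mem, Finset.univ_inter, Finset.sum_const, smul_eq_mul]
  -- At each vertex, `|F_v|` differs from `k₀` times the indicator of `A` by exactly the minimum;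
  -- this and `h2` are the two directions.
  have h1 : 2 * F.card ≤ M + A.card * k₀ := by
    rw [hAk, hM, ← hsum, ← Finset.sum_add_distrib]
    refine Finset.sum_le_sum fun v _ => ?_
    have hle := card_star_le hreg hF v
    split_ifs with h <;> rw [hmem] at h <;> omega
  have h2 : A.card * k₀ ≤ 2 * F.card + M := by
    rw [hAk, hM, ← hsum, ← Finset.sum_add_distrib]
    refine Finset.sum_le_sum fun v _ => ?_
    have hle := card_star_le hreg hF v
    split_ifs with h <;> rw [hmem] at h <;> omega
  clear_value A M lam
  have h3 : 2 * (2 * F.card) ≤ Fintype.card V * k₀ := by omega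
  have hn' : (0 : ℝ) < Fintype.card V := by exact_mod_cast hn
  have hk : (0 : ℝ) < k₀ := by exact_mod_cast (by omega : 0 < k₀)
  have hAM' : ((X.coboundary₀ A).card : ℝ) ≤ M := by exact_mod_cast hAM
  have := local_imbalance_bound (S := 2 * F.card) hn' hk (L := 1 - lam) (by linarith)
    (by linarith) (Nat.cast_nonneg A.card)
    (hcut.trans (mul_le_mul_of_nonneg_left hAM' hn'.le)) (by exact_mod_cast h1)
    (by exact_mod_cast h2) (by exact_mod_cast h3) (Nat.cast_nonneg M)
  linarith

/-- The second eigenvalue of the underlying graph is not very negative. -/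
theorem neg_half_le_secondEigenvalue (hreg : X.IsRegular k₀ k₁) (hk₀ : 2 ≤ k₀)
    (hn : 3 ≤ Fintype.card V)
    (hlt : normalizedSecondEigenvalue X.underlyingGraph k₀ < 1 / 2) :
    -(1 / 2) ≤ normalizedSecondEigenvalue X.underlyingGraph k₀ := by
  obtain ⟨v⟩ : Nonempty V := Fintype.card_pos_iff.1 (by omega)
  have hcut := le_card_coboundary₀ hreg (by omega) (by linarith) {v}
  have hle : (X.coboundary₀ {v}).card ≤ k₀ := by
    rw [← hreg.1 v]
    refine Finset.card_le_card fun e he => ?_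
    obtain ⟨u, hu, w, hw, h, rfl⟩ := mem_coboundary₀.1 he
    rw [Finset.mem_singleton.1 hu] at h ⊢
    exact Finset.mem_filter.2 ⟨h, by simp⟩
  have hle' : ((X.coboundary₀ {v}).card : ℝ) ≤ k₀ := by exact_mod_cast hle
  set lam := normalizedSecondEigenvalue X.underlyingGraph k₀
  have hk : (0 : ℝ) < k₀ := by exact_mod_cast (by omega : 0 < k₀)
  have hn' : (3 : ℝ) ≤ Fintype.card V := by exact_mod_cast hn
  set n : ℝ := (Fintype.card V : ℝ)
  rw [Finset.card_singleton] at hcut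
  push_cast at hcut
  -- The cut of one vertex gives `1 - λ ≤ n/(n - 1) ≤ 3/2`, as `n ≥ 3`.
  have h1 : k₀ * ((1 - lam) * (n - 1)) ≤ k₀ * n := by nlinarith
  have h2 := le_of_mul_le_mul_left h1 hk
  by_contra! hcon
  nlinarith

/-- The edge expansion of the edge graph. -/
theorem expansion_edgeGraph (hdim : X.IsTwoDimensional) (hreg : X.IsRegular k₀ k₁)
    {ε μ : ℝ} (hcos : X.IsCosystolicExpander k₀ k₁ ε μ)
    (hlt : normalizedSecondEigenvalue X.underlyingGraph k₀ < 1 / 2)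
    (hlarge : 3 / μ ≤ (Fintype.card V : ℝ)) (F : Finset X.Edge)
    (hcard : 2 * F.card ≤ Fintype.card X.Edge) :
    3 / 20 * ε * (1 - normalizedSecondEigenvalue X.underlyingGraph k₀) * (2 * k₁) * F.card ≤
      cutWeight X.edgeGraph.kernel F := by
  have hk₀ := two_le_degree hdim hreg
  have hn := three_le_card hdim
  have hZ := fun Z => eq_empty_or_degree_le_card_of_mem_cocycles₁ hreg hk₀ hcos hlt hlarge (Z := Z)
  refine le_trans ?_ (sum_coboundary₁_le_cutWeight hreg F)
  set F' : Finset (Finset V) := F.map (Function.Embedding.subtype _) with hF'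
  have hsub : F' ⊆ X.edges := by
    intro e he
    obtain ⟨e', -, rfl⟩ := Finset.mem_map.1 he
    exact e'.2
  have hc : F'.card = F.card := Finset.card_map _
  have h1 := card_le_sum_min hreg hk₀ (by omega)
    (neg_half_le_secondEigenvalue hreg hk₀ hn hlt) hlt hsub
    (by rw [hc]; simpa using hcard)
  have h2 : ε * k₁ * ((∑ v, min (F'.filter (v ∈ ·)).card
      (k₀ - (F'.filter (v ∈ ·)).card) : ℕ) : ℝ) ≤
      ((∑ v, (X.coboundary₁ (F'.filter (v ∈ ·))).card : ℕ) : ℝ) := by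
    push_cast [-Nat.cast_min]
    rw [Finset.mul_sum]
    exact Finset.sum_le_sum fun v _ =>
      mul_min_le_card_coboundary₁ hcos hZ ((Finset.filter_subset _ _).trans hsub)
  refine le_trans ?_ h2
  rw [hc] at h1
  have h3 : 0 ≤ ε * k₁ := mul_nonneg hcos.1.le (Nat.cast_nonneg _)
  nlinarith [mul_le_mul_of_nonneg_left h1 h3]

end AbstractSimplicialComplex

/-! ### The random walk on edges -/

namespace AbstractSimplicialComplex

variable {V : Type*} [Fintype V] [DecidableEq V] {X : AbstractSimplicialComplex V} {k₀ k₁ : ℕ}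

theorem walkStep_eq (hreg : X.IsRegular k₀ k₁) (p : X.Edge → ℝ) (f : X.Edge) :
    X.walkStep p f = (2 * (k₁ : ℝ))⁻¹ * ∑ e, X.edgeGraph.kernel f e * p e := by
  classical
  have hmem : ∀ e f : X.Edge, X.edgeGraph.kernel e f = if f ∈ X.edgeNeighbors e then 1 else 0 := by
    intro e f
    rw [SimpleGraph.kernel_eq_ite]
    exact if_congr (by simp [edgeNeighbors, edgeGraph]) rfl rfl
  have hcard : ∀ e : X.Edge, ((X.edgeNeighbors e).card : ℝ) = 2 * k₁ := by
    intro e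
    rw [← sum_kernel_edgeGraph hreg e]
    simp only [hmem, Finset.sum_boole, Finset.filter_univ_mem]
  rw [walkStep, Finset.mul_sum]
  refine Finset.sum_congr rfl fun e _ => ?_
  rw [hcard, SimpleGraph.kernel_symm, hmem]
  split_ifs <;> simp [mul_comm]

theorem ncard_neighborSet_edgeGraph (hreg : X.IsRegular k₀ k₁) (e : X.Edge) :
    (X.edgeGraph.neighborSet e).ncard = 2 * k₁ := by
  classical
  have h := sum_kernel_edgeGraph hreg e
  simp only [SimpleGraph.kernel_eq_ite, Finset.sum_boole] at h
  have hset : X.edgeGraph.neighborSet e = ↑(Finset.univ.filter fun f => X.edgeGraph.Adj e f) := by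
    ext f; simp
  rw [hset, Set.ncard_coe_finset]
  exact_mod_cast h

/-- A contraction estimate for the walk operator on functions of mean zero gives rapid mixing. -/
theorem isRapidlyMixing_of_contraction (hreg : X.IsRegular k₀ k₁) (hk₁ : 1 ≤ k₁)
    (hE : 0 < X.edges.card) {a : ℝ} (ha : 0 < a)
    (h : ∀ x : X.Edge → ℝ, ∑ e, x e = 0 →
      ∑ e, (∑ f, X.edgeGraph.kernel e f * x f) ^ 2 ≤ (a * (2 * k₁)) ^ 2 * ∑ e, x e ^ 2) :
    X.IsRapidlyMixing a := by
  refine ⟨ha, fun p₀ hp₀ i => ?_⟩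
  have hk : (0 : ℝ) < 2 * k₁ := by
    have : (1 : ℝ) ≤ k₁ := by exact_mod_cast hk₁
    linarith
  set m : ℝ := (X.edges.card : ℝ) with hm
  have hm0 : 0 < m := by rw [hm]; exact_mod_cast hE
  have hcard : ((Finset.univ : Finset X.Edge).card : ℝ) = m := by simp [hm]
  have key : ∀ i, ∑ e, (X.walkDistribution p₀ i e - 1 / m) = 0 ∧
      ∑ e, (X.walkDistribution p₀ i e - 1 / m) ^ 2 ≤ (a ^ i) ^ 2 := by
    intro i
    induction i with
    | zero =>
      have hs : ∑ e, (p₀ e - 1 / m) = 0 := by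
        rw [Finset.sum_sub_distrib, hp₀.2, Finset.sum_const, nsmul_eq_mul, hcard]
        field_simp; ring
      refine ⟨hs, ?_⟩
      -- This is `p² ≤ p` in disguise, arranged so that the right side sums to `1 - 1/m`.
      have h1 : ∀ e, (p₀ e - 1 / m) ^ 2 ≤ p₀ e - 1 / m * (p₀ e - 1 / m) - 1 / m * p₀ e := by
        intro e
        have hle : p₀ e ≤ 1 := by
          rw [← hp₀.2]
          exact Finset.single_le_sum (fun e _ => hp₀.1 e) (Finset.mem_univ e)
        nlinarith [hp₀.1 e]
      refine (Finset.sum_le_sum fun e _ => h1 e).trans ?_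
      rw [Finset.sum_sub_distrib, Finset.sum_sub_distrib, ← Finset.mul_sum, ← Finset.mul_sum, hs,
        hp₀.2]
      have : 0 < 1 / m := by positivity
      simp; positivity
    | succ i ih =>
      set x : X.Edge → ℝ := fun e => X.walkDistribution p₀ i e - 1 / m with hx
      -- All row sums are `2k₁`, so the uniform distribution is stationary and the deviation evolves
      -- by the same operator.
      have hstep : ∀ e, X.walkDistribution p₀ (i + 1) e - 1 / m =
          (2 * (k₁ : ℝ))⁻¹ * ∑ f, X.edgeGraph.kernel e f * x f := by
        intro e
        rw [walkDistribution, Function.iterate_succ_apply', walkStep_eq hreg]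
        simp only [hx, mul_sub, Finset.sum_sub_distrib, ← Finset.sum_mul,
          sum_kernel_edgeGraph hreg]
        rw [← mul_assoc, inv_mul_cancel₀ hk.ne', one_mul]
        rfl
      constructor
      · simp only [hstep]
        rw [← Finset.mul_sum]
        have := sum_kernel_mul_comm X.edgeGraph.kernel_symm (fun _ => 1) x
        simp only [one_mul, mul_one, sum_kernel_edgeGraph hreg, ← Finset.mul_sum] at this
        rw [this, ih.1, mul_zero, mul_zero]
      · simp only [hstep, mul_pow]
        rw [← Finset.mul_sum]
        calc ((2 * (k₁ : ℝ))⁻¹) ^ 2 * ∑ e, (∑ f, X.edgeGraph.kernel e f * x f) ^ 2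
            ≤ ((2 * (k₁ : ℝ))⁻¹) ^ 2 * ((a * (2 * k₁)) ^ 2 * (a ^ i) ^ 2) :=
              mul_le_mul_of_nonneg_left ((h x ih.1).trans
                (mul_le_mul_of_nonneg_left ih.2 (sq_nonneg _))) (sq_nonneg _)
          _ = (a ^ (i + 1)) ^ 2 := by
              rw [pow_succ a i]; field_simp
  rw [EuclideanSpace.norm_eq]
  refine Real.sqrt_le_iff.2 ⟨by positivity, ?_⟩
  simpa only [Real.norm_eq_abs, sq_abs] using (key i).2

end AbstractSimplicialComplex

/-! ### The constant and the conclusion -/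

/-- Numerical bounds for the constant in the mixing rate. -/
theorem mixing_constant_bounds {lam : ℝ} (h0 : -(1 / 2) ≤ lam) (h1 : lam < 1 / 2) :
    0 < 3 * Real.sqrt ((1 + 2 * lam) ^ 2 + 32) - 2 * lam - 17 ∧
      3 * Real.sqrt ((1 + 2 * lam) ^ 2 + 32) - 2 * lam - 17 ≤ 6 / 5 * (1 - lam) := by
  set s := Real.sqrt ((1 + 2 * lam) ^ 2 + 32)
  constructor
  · have : (2 * lam + 17) / 3 < s := by
      refine Real.lt_sqrt_of_sq_lt ?_
      -- After clearing denominators the difference of the squares is `32(1/2 - λ)²`, so the strict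
      -- gap hypothesis is what makes the constant positive.
      nlinarith [mul_pos (sub_pos.2 h1) (sub_pos.2 h1)]
    linarith
  · have : s ≤ (2 * lam + 17 + 6 / 5 * (1 - lam)) / 3 := by
      refine Real.sqrt_le_iff.2 ⟨by linarith, ?_⟩
      nlinarith [mul_nonneg (sub_nonneg.2 h0) (sub_pos.2 h1).le]
    linarith

theorem theorem3p1 {V : Type*} [Fintype V] [DecidableEq V]
    (X : AbstractSimplicialComplex V) (hdim : X.IsTwoDimensional)
    (k₀ k₁ : ℕ) (hreg : X.IsRegular k₀ k₁)
    (ε μ : ℝ) (hcos : X.IsCosystolicExpander k₀ k₁ ε μ)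
    (lam : ℝ) (hlam : lam = normalizedSecondEigenvalue X.underlyingGraph k₀)
    (hgap : lam < 1 / 2) (hlarge : 3 / μ ≤ (Fintype.card V : ℝ))
    (a : ℝ)
    (ha : a = 1 - ε ^ 2 / 128 * (3 * Real.sqrt ((1 + 2 * lam) ^ 2 + 32) - 2 * lam - 17) ^ 2) :
    X.IsRapidlyMixing a ∧ IsSpectralExpander X.edgeGraph (2 * k₁) a := by
  subst hlam
  set lam := normalizedSecondEigenvalue X.underlyingGraph k₀ with hlam
  have hk₀ := AbstractSimplicialComplex.two_le_degree hdim hreg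
  have hk₁ := AbstractSimplicialComplex.one_le_edge_degree hdim hreg
  have hn := AbstractSimplicialComplex.three_le_card hdim
  have hE : 3 ≤ Fintype.card X.Edge := by
    have := AbstractSimplicialComplex.two_mul_card_edges hreg
    rw [Fintype.card_coe]
    nlinarith
  have hε : ε ≤ 1 := AbstractSimplicialComplex.eps_le_one hdim hreg hcos fun Z hZ =>
    AbstractSimplicialComplex.eq_empty_or_degree_le_card_of_mem_cocycles₁ hreg hk₀ hcos hgap hlarge
      hZ
  have hε0 : 0 < ε := hcos.1
  have hlow : -(1 / 2) ≤ lam :=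
    AbstractSimplicialComplex.neg_half_le_secondEigenvalue hreg hk₀ hn hgap
  have hexp := AbstractSimplicialComplex.expansion_edgeGraph hdim hreg hcos hgap hlarge
  rw [← hlam] at hexp
  clear_value lam
  obtain ⟨hC0, hC⟩ := mixing_constant_bounds hlow hgap
  set C := 3 * Real.sqrt ((1 + 2 * lam) ^ 2 + 32) - 2 * lam - 17
  have hk : (1 : ℝ) ≤ k₁ := by exact_mod_cast hk₁
  have hε2 : ε ^ 2 ≤ 1 := by nlinarith
  have hC2 : C ^ 2 ≤ 4 := by nlinarith
  have ha_half : 1 / 2 ≤ a := by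
    have : ε ^ 2 * C ^ 2 ≤ 1 * 4 := mul_le_mul hε2 hC2 (sq_nonneg _) zero_le_one
    rw [ha]; linarith
  have ha_one : a < 1 := by
    have : 0 < ε ^ 2 / 128 * C ^ 2 := by positivity
    linarith
  have hcheeger : ∀ x : X.Edge → ℝ, ∑ e, x e = 0 →
      quadForm X.edgeGraph.kernel x ≤ a * (2 * k₁) * ∑ e, x e ^ 2 := by
    intro x hx
    -- The factor `6/5` in the bound on `C` gives exactly `3/20` after division by 8; with `h =
    -- εC/8`, Cheeger's `1 - h²/2` is `α`.
    have h1 : ε * C / 8 ≤ 3 / 20 * ε * (1 - lam) := by nlinarith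
    have := cheeger X.edgeGraph.kernel_symm X.edgeGraph.kernel_nonneg (k := 2 * k₁)
      (h := ε * C / 8) (by positivity) (by positivity)
      (AbstractSimplicialComplex.sum_kernel_edgeGraph hreg)
      (fun F hF => le_trans (mul_le_mul_of_nonneg_right
        (mul_le_mul_of_nonneg_right h1 (by positivity)) (Nat.cast_nonneg _)) (hexp F hF)) x hx
    refine this.trans (le_of_eq ?_)
    rw [ha]; ring
  have hlower : ∀ x : X.Edge → ℝ,
      -(k₁ : ℝ) * ∑ e, x e ^ 2 ≤ quadForm X.edgeGraph.kernel x :=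
    AbstractSimplicialComplex.neg_le_quadForm_edgeGraph hreg
  -- Since `α ≥ 1/2`, the lower bound `-k₁` also serves as `-α · 2k₁`.
  have hak : (k₁ : ℝ) ≤ a * (2 * k₁) := by nlinarith
  constructor
  · refine AbstractSimplicialComplex.isRapidlyMixing_of_contraction hreg hk₁
      (by rw [Fintype.card_coe] at hE; omega) (by linarith) ?_
    refine sum_sq_kernel_le X.edgeGraph.kernel_symm
      (AbstractSimplicialComplex.sum_kernel_edgeGraph hreg) (by positivity) fun x hx => ?_
    refine abs_le.2 ⟨?_, hcheeger x hx⟩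
    have h0 : (0 : ℝ) ≤ ∑ e, x e ^ 2 := Finset.sum_nonneg fun _ _ => sq_nonneg _
    have := hlower x
    nlinarith [mul_le_mul_of_nonneg_right hak h0]
  · refine ⟨AbstractSimplicialComplex.ncard_neighborSet_edgeGraph hreg, by linarith, ha_one, ?_⟩
    have h2 := secondEigenvalue_le X.edgeGraph (by omega) hcheeger
    have hanti := adjEigenvalue_antitone X.edgeGraph (i := 1) (j := Fintype.card X.Edge - 1)
      (by omega) (by omega)
    have hl := le_adjEigenvalue X.edgeGraph hlower (i := Fintype.card X.Edge - 1) (by omega)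
    have hpos : (0 : ℝ) < ((2 * k₁ : ℕ) : ℝ) := by push_cast; linarith
    refine max_le ?_ ?_ <;> refine abs_le.2 ⟨?_, ?_⟩ <;>
      simp only [normalizedSecondEigenvalue, normalizedLeastEigenvalue] <;>
      first | rw [le_div_iff₀ hpos] | rw [div_le_iff₀ hpos]
    all_goals push_cast; linarith
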